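/- **Setting.** Let $l\ge 2$, let $n_1,\dots,n_l\ge 3$, and let $\mathcal M_1,\dots,\mathcal M_l$ be compact connected smooth Riemannian manifolds without boundary with $n_i+\dim\mathcal M_i=N$ for all $i$. Let $\mathcal M$ be a complete smooth $N$-dimensional Riemannian manifold that is a connected sum $(\mathbb R^{n_1}\times\mathcal M_1)\#\cdots\#(\mathbb R^{n_l}\times\mathcal M_l)$: there is a compact set $K\subset\mathcal M$ with non-empty interior such that $\mathcal M\setminus K$ is the disjoint union of open sets $E_1,\dots,E_l$, where $E_i$ is isometric (as a Riemannian manifold) to $(\mathbb R^{n_i}\times\mathcal M_i)\setminus K_i$ for some compact $K_i\subset\mathbb R^{n_i}\times\mathcal M_i$. Put $n^*=\min_i n_i$. Let $\mu$ be the Riemannian measure, and let $L^p(\mathcal M)$ and $L^p(T\mathcal M)$ be the spaces of real-valued functions and of vector fields $X$ with $\int|X|^p\,d\mu<\infty$. Let $\Delta\ge 0$ be the Laplace–Beltrami operator, i.e. the self-adjoint operator on $L^2(\mathcal M)$ of the quadratic form $\int|\nabla u|^2\,d\mu$ on $W^{1,2}(\mathcal M)$ (the closure of $C_c^\infty(\mathcal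 M)$). For an integer $m\ge1$ and $f\in L^2(\mathcal M)$ let $$M_m^{res,\nabla}f=\sup_{t>0}\bigl|\sqrt t\,\nabla(1+t\Delta)^{-m}f\bigr|,$$ the supremum being taken in the lattice of measurable functions modulo null sets (the least measurable function that dominates every $|\sqrt t\,\nabla(1+t\Delta)^{-m}f|$, $t>0$, almost everywhere). A family $\mathcal T$ of bounded operators between Banach spaces $X$ and $Y$ is *R-bounded* if there is a constant $C\ge 0$ such that $\bigl\|\sum_{j=1}^J\varepsilon_jT_jx_j\bigr\|_{L^2(\Omega;Y)}\le C\bigl\|\sum_{j=1}^J\varepsilon_jx_j\bigr\|_{L^2(\Omega;X)}$ for all $J$, all $T_1,\dots,T_J\in\mathcal T$ and all $x_1,\dots,x_J\in X$, where $(\varepsilon_j)$ is a Rademacher sequence (independent, $\pm1$ with probability $\tfrac12$ each) on a probability space $\Omega$. **Theorem.** Let $m\ge1$ be an integer and $1<p<n^*$. Suppose that the Fefferman–Stein inequality for $M_m^{res,\nabla}$ holds on $L^p(\mathcal M)$: there is a constant $A>0$ such that $$\Bigl\|\Bigl(\sum_{i=1}^\infty (M_m^{res,\nabla}f_i)^2\Bigr)^{1/2}\Bigr\|_{L^p}\le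 A\,\Bigl\|\Bigl(\sum_{i=1}^\infty|f_i|^2\Bigr)^{1/2}\Bigr\|_{L^p}$$ for all sequences $(f_i)_{i\ge1}$ in $L^2(\mathcal M)\cap L^p(\mathcal M)$. Then, for every $t>0$, the operator $\sqrt t\,\nabla(1+t\Delta)^{-m}$, defined on $L^2(\mathcal M)\cap L^p(\mathcal M)$, extends to a bounded operator from $L^p(\mathcal M)$ to $L^p(T\mathcal M)$, and the family $$\{\sqrt t\,\nabla(1+t\Delta)^{-m}:t>0\}$$ of these operators is R-bounded. -/

import Mathlib

open Set Filter Topology MeasureTheory ProbabilityTheory Bundle Manifold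
open scoped ENNReal NNReal ContDiff

noncomputable section

/-! ### Randomized boundedness of families of operators -/

/-- A Rademacher sequence on a probability space: independent random variables, each of which takes
the values `1` and `-1` with probability `1/2`. -/
structure IsRademacherSequence {S : Type} [MeasurableSpace S] (P : Measure S) (ε : ℕ → S → ℝ) :
    Prop where
  measurable : ∀ j, Measurable (ε j)
  indep : iIndepFun ε P
  prob_one : ∀ j, P {s | ε j s = 1} = 1 / 2
  prob_neg_one : ∀ j, P {s | ε j s = -1} = 1 / 2

/-- `R`-boundedness of a family `𝒯` of bounded operators between normed spaces. -/
def RBounded {X Y : Type*} [NormedAddCommGroup X] [NormedSpace ℝ X]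
    [NormedAddCommGroup Y] [NormedSpace ℝ Y] (𝒯 : Set (X →L[ℝ] Y)) : Prop :=
  ∃ C : ℝ≥0, ∀ (S : Type) [MeasurableSpace S] (P : Measure S) [IsProbabilityMeasure P]
    (ε : ℕ → S → ℝ), IsRademacherSequence P ε →
    ∀ (J : ℕ) (T : Fin J → X →L[ℝ] Y), (∀ j, T j ∈ 𝒯) → ∀ x : Fin J → X,
      eLpNorm (fun s => ∑ j : Fin J, ε j s • T j (x j)) 2 P
        ≤ C * eLpNorm (fun s => ∑ j : Fin J, ε j s • x j) 2 P

/-! ### Measurable vector fields and the spaces `L^p(TM)` -/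

/-- Vector fields on the `N`-dimensional manifold `M`, without any regularity. -/
abbrev VField (N : ℕ) (M : Type*) [TopologicalSpace M]
    [ChartedSpace (EuclideanSpace ℝ (Fin N)) M] : Type _ :=
  ∀ x : M, TangentSpace (𝓡 N) x

namespace VField

section Measurability

variable {N : ℕ} {M : Type*} [TopologicalSpace M] [ChartedSpace (EuclideanSpace ℝ (Fin N)) M]
  [IsManifold (𝓡 N) ∞ M] [MeasurableSpace M]

/-- A vector field is (almost everywhere strongly) measurable if its components in the coordinates
of each of the distinguished charts (which cover `M`) are. -/
def AEMeas (X : VField N M) (μ : Measure M) : Prop :=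
  ∀ x₀ : M, AEStronglyMeasurable
    (fun x => (trivializationAt (EuclideanSpace ℝ (Fin N))
      (TangentSpace (𝓡 N)) x₀).continuousLinearMapAt ℝ x (X x))
    (μ.restrict (chartAt (EuclideanSpace ℝ (Fin N)) x₀).source)

theorem AEMeas.add {X Y : VField N M} {μ : Measure M} (hX : X.AEMeas μ)
    (hY : Y.AEMeas μ) : VField.AEMeas (N := N) (X + Y) μ := by
  intro x₀
  refine ((hX x₀).add (hY x₀)).congr (Eventually.of_forall fun x => ?_)
  simp only [Pi.add_apply, map_add]

theorem AEMeas.smul {X : VField N M} {μ : Measure M} (c : ℝ) (hX : X.AEMeas μ) :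
    VField.AEMeas (N := N) (c • X) μ := by
  intro x₀
  refine ((hX x₀).const_smul c).congr (Eventually.of_forall fun x => ?_)
  simp only [Pi.smul_apply, map_smul]

end Measurability

section Norm

variable {N : ℕ} {M : Type*} [TopologicalSpace M] [ChartedSpace (EuclideanSpace ℝ (Fin N)) M]
  [IsManifold (𝓡 N) ∞ M] [RiemannianBundle (fun x : M => TangentSpace (𝓡 N) x)]
  [MeasurableSpace M]

/-- `X ∈ ℒ^p(TM)`: the vector field `X` is measurable and its pointwise length is in `ℒ^p`. -/
def MemLp (X : VField N M) (p : ℝ≥0∞) (μ : Measure M) : Prop :=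
  X.AEMeas μ ∧ eLpNorm (fun x => ‖X x‖) p μ < ⊤

/-- The gradient of a function: the vector field that represents its differential. -/
def grad (φ : M → ℝ) : VField N M := fun x =>
  haveI : FiniteDimensional ℝ (TangentSpace (𝓡 N) x) :=
    inferInstanceAs (FiniteDimensional ℝ (EuclideanSpace ℝ (Fin N)))
  haveI : CompleteSpace (TangentSpace (𝓡 N) x) := FiniteDimensional.complete ℝ _
  (InnerProductSpace.toDual ℝ (TangentSpace (𝓡 N) x)).symm (mfderiv (𝓡 N) 𝓘(ℝ, ℝ) φ x)

variable [IsContMDiffRiemannianBundle (𝓡 N) ∞ (EuclideanSpace ℝ (Fin N))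
    (fun x : M => TangentSpace (𝓡 N) x)] [SecondCountableTopology M] [BorelSpace M]

/-- The pointwise length of a measurable vector field is measurable. -/
theorem AEMeas.norm {X : VField N M} {μ : Measure M} (hX : X.AEMeas μ) :
    AEStronglyMeasurable (fun x => ‖X x‖) μ := by
  have hloc : ∀ x₀ : M, AEStronglyMeasurable (fun x => ‖X x‖)
      (μ.restrict (chartAt (EuclideanSpace ℝ (Fin N)) x₀).source) := by
    intro x₀
    have : IsContinuousRiemannianBundle (EuclideanSpace ℝ (Fin N))
        (fun x : M => TangentSpace (𝓡 N) x) := by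
      obtain ⟨g, hg, hg'⟩ := IsContMDiffRiemannianBundle.exists_contMDiff (IB := 𝓡 N) (n := ∞)
        (F := EuclideanSpace ℝ (Fin N)) (E := fun x : M => TangentSpace (𝓡 N) x)
      exact ⟨g, hg.continuous, hg'⟩
    let e := trivializationAt (EuclideanSpace ℝ (Fin N)) (TangentSpace (𝓡 N) (M := M)) x₀
    have hU : MeasurableSet (chartAt (EuclideanSpace ℝ (Fin N)) x₀).source :=
      (chartAt (EuclideanSpace ℝ (Fin N)) x₀).open_source.measurableSet
    let b := EuclideanSpace.basisFun (Fin N) ℝ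
    let s : Fin N → ∀ x : M, TangentSpace (𝓡 N) x := fun i x => e.symm x (b i)
    have hs : ∀ i, ContinuousOn
        (fun x => TotalSpace.mk' (EuclideanSpace ℝ (Fin N)) x (s i x)) e.baseSet := fun i =>
      e.continuousOn_symm.comp (f := fun x : M => (x, b i)) (by fun_prop)
        (fun x hx => ⟨hx, mem_univ _⟩)
    have hss : ∀ i j, AEStronglyMeasurable (fun x => inner ℝ (s i x) (s j x))
        (μ.restrict e.baseSet) := fun i j =>
      ((hs i).inner_bundle (hs j)).aestronglyMeasurable hU
    have hξ : ∀ i, AEStronglyMeasurable (fun x => (e.continuousLinearMapAt ℝ x (X x)) i)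
        (μ.restrict e.baseSet) := fun i =>
      (EuclideanSpace.proj (𝕜 := ℝ) i).continuous.comp_aestronglyMeasurable (hX x₀)
    have hsum : AEStronglyMeasurable (fun x => √(∑ i, ∑ j,
        (e.continuousLinearMapAt ℝ x (X x)) i * (e.continuousLinearMapAt ℝ x (X x)) j *
          inner ℝ (s i x) (s j x))) (μ.restrict e.baseSet) := by
      refine Real.continuous_sqrt.comp_aestronglyMeasurable ?_
      refine Finset.aestronglyMeasurable_fun_sum _ fun i _ => ?_
      refine Finset.aestronglyMeasurable_fun_sum _ fun j _ => ?_
      exact ((hξ i).mul (hξ j)).mul (hss i j)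
    refine hsum.congr ?_
    filter_upwards [ae_restrict_mem hU] with x hx
    have hx' : x ∈ e.baseSet := hx
    have hXx : X x = ∑ i, (e.continuousLinearMapAt ℝ x (X x)) i • s i x := by
      have h1 : e.symmL ℝ x (e.continuousLinearMapAt ℝ x (X x)) = X x :=
        e.symmL_continuousLinearMapAt hx' _
      conv_lhs => rw [← h1, ← b.sum_repr (e.continuousLinearMapAt ℝ x (X x)), map_sum]
      refine Finset.sum_congr rfl fun i _ => ?_
      rw [map_smul, e.symmL_apply hx']
      simp [s, b]
    rw [norm_eq_sqrt_real_inner]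
    congr 1
    conv_rhs => rw [hXx]
    simp only [sum_inner, inner_sum, real_inner_smul_left, real_inner_smul_right]
    rw [Finset.sum_comm]
    refine Finset.sum_congr rfl fun i _ => Finset.sum_congr rfl fun j _ => ?_
    ring
  obtain ⟨S, hS, hcov⟩ := TopologicalSpace.countable_cover_nhds
    (fun x : M => (chartAt (EuclideanSpace ℝ (Fin N)) x).open_source.mem_nhds
      (mem_chart_source (EuclideanSpace ℝ (Fin N)) x))
  rw [← Measure.restrict_univ (μ := μ), ← hcov, biUnion_eq_iUnion]
  have := hS.to_subtype
  rw [aestronglyMeasurable_iUnion_iff]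
  exact fun i => hloc i

variable (N M) in
/-- The subspace `ℒ^p(TM)` of the space of all vector fields (before identification of almost everywhere equal
ones), for `1 ≤ p`. -/
def preLpSubmodule (p : ℝ≥0∞) [Fact (1 ≤ p)] (μ : Measure M) : Submodule ℝ (VField N M) where
  carrier := {X | X.MemLp p μ}
  zero_mem' := by
    refine ⟨fun x₀ => ?_, ?_⟩
    · simpa using! aestronglyMeasurable_const
    · simp
  add_mem' := by
    intro X Y hX hY
    refine ⟨hX.1.add hY.1, ?_⟩
    calc eLpNorm (fun x => ‖(X + Y) x‖) p μ
        ≤ eLpNorm ((fun x => ‖X x‖) + (fun x => ‖Y x‖)) p μ :=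
          eLpNorm_mono_real fun x => by simpa using norm_add_le (X x) (Y x)
      _ ≤ _ := eLpNorm_add_le hX.1.norm hY.1.norm Fact.out
      _ < ⊤ := ENNReal.add_lt_top.2 ⟨hX.2, hY.2⟩
  smul_mem' := by
    intro c X hX
    refine ⟨hX.1.smul c, ?_⟩
    have : (fun x => ‖(c • X) x‖) = ‖c‖ • (fun x => ‖X x‖) := by
      funext x
      simp [norm_smul]
    rw [this, eLpNorm_const_smul]
    exact ENNReal.mul_lt_top (by simp) hX.2

end Norm

section Quotient

variable (N : ℕ) (M : Type*) [TopologicalSpace M] [ChartedSpace (EuclideanSpace ℝ (Fin N)) M]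
  [IsManifold (𝓡 N) ∞ M] [RiemannianBundle (fun x : M => TangentSpace (𝓡 N) x)]
  [MeasurableSpace M] [IsContMDiffRiemannianBundle (𝓡 N) ∞ (EuclideanSpace ℝ (Fin N))
    (fun x : M => TangentSpace (𝓡 N) x)] [SecondCountableTopology M] [BorelSpace M]
  (p : ℝ≥0∞) [Fact (1 ≤ p)] (μ : Measure M)

/-- The vector space `ℒ^p(TM)`, as a type that carries no topology yet (in particular not the one
of pointwise convergence). -/
def PreLp : Type _ := preLpSubmodule N M p μ

instance PreLp.addCommGroup : AddCommGroup (PreLp N M p μ) :=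
  inferInstanceAs (AddCommGroup (preLpSubmodule N M p μ))

instance PreLp.module : Module ℝ (PreLp N M p μ) :=
  inferInstanceAs (Module ℝ (preLpSubmodule N M p μ))

/-- The `L^p` seminorm of a vector field is the `L^p` norm of its pointwise length. -/
instance PreLp.seminormedAddCommGroup : SeminormedAddCommGroup (PreLp N M p μ) :=
  AddGroupSeminorm.toSeminormedAddCommGroup
    { toFun := fun X => (eLpNorm (fun x => ‖X.1 x‖) p μ).toReal
      map_zero' := by
        change (eLpNorm (fun x : M => ‖(0 : TangentSpace (𝓡 N) x)‖) p μ).toReal = 0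
        simp
      add_le' := by
        intro X Y
        rw [← ENNReal.toReal_add X.2.2.ne Y.2.2.ne]
        refine ENNReal.toReal_mono (ENNReal.add_lt_top.2 ⟨X.2.2, Y.2.2⟩).ne ?_
        change eLpNorm (fun x => ‖X.1 x + Y.1 x‖) p μ ≤ _
        calc eLpNorm (fun x => ‖X.1 x + Y.1 x‖) p μ
            ≤ eLpNorm ((fun x => ‖X.1 x‖) + (fun x => ‖Y.1 x‖)) p μ :=
              eLpNorm_mono_real fun x => by simpa using norm_add_le (X.1 x) (Y.1 x)
          _ ≤ _ := eLpNorm_add_le X.2.1.norm Y.2.1.norm Fact.out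
      neg' := by
        intro X
        change (eLpNorm (fun x => ‖-X.1 x‖) p μ).toReal = _
        simp }

instance PreLp.normedSpace : NormedSpace ℝ (PreLp N M p μ) where
  norm_smul_le := by
    intro c X
    change (eLpNorm (fun x => ‖c • X.1 x‖) p μ).toReal
      ≤ ‖c‖ * (eLpNorm (fun x => ‖X.1 x‖) p μ).toReal
    have : (fun x => ‖c • X.1 x‖) = ‖c‖ • (fun x => ‖X.1 x‖) := by
      funext x
      simp [norm_smul]
    rw [this, eLpNorm_const_smul, ENNReal.toReal_mul]
    simp

end Quotient

end VField

section LpVField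

variable (N : ℕ) (M : Type*) [TopologicalSpace M] [ChartedSpace (EuclideanSpace ℝ (Fin N)) M]
  [IsManifold (𝓡 N) ∞ M] [RiemannianBundle (fun x : M => TangentSpace (𝓡 N) x)]
  [MeasurableSpace M] [IsContMDiffRiemannianBundle (𝓡 N) ∞ (EuclideanSpace ℝ (Fin N))
    (fun x : M => TangentSpace (𝓡 N) x)] [SecondCountableTopology M] [BorelSpace M]
  (p : ℝ≥0∞) [Fact (1 ≤ p)] (μ : Measure M)

/-- The Lebesgue space `L^p(TM)` of (classes of almost everywhere equal) vector fields. -/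
def LpVField : Type _ := SeparationQuotient (VField.PreLp N M p μ)

instance LpVField.normedAddCommGroup : NormedAddCommGroup (LpVField N M p μ) :=
  inferInstanceAs (NormedAddCommGroup (SeparationQuotient (VField.PreLp N M p μ)))

instance LpVField.normedSpace : NormedSpace ℝ (LpVField N M p μ) :=
  inferInstanceAs (NormedSpace ℝ (SeparationQuotient (VField.PreLp N M p μ)))

variable {N M p μ}

/-- The class in `L^p(TM)` of a vector field in `ℒ^p(TM)`. -/
def VField.MemLp.toLp {X : VField N M} (hX : X.MemLp p μ) : LpVField N M p μ :=
  SeparationQuotient.mk (⟨X, hX⟩ : VField.PreLp N M p μ)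

/-- The norm of `L^p(TM)` is the `L^p` norm of the pointwise length. -/
theorem VField.MemLp.norm_toLp {X : VField N M} (hX : X.MemLp p μ) :
    ‖hX.toLp‖ = (eLpNorm (fun x => ‖X x‖) p μ).toReal := rfl

end LpVField

/-! ### The Laplace–Beltrami operator, its resolvents and the vertical maximal function -/

section Laplacian

variable {N : ℕ} {M : Type*} [TopologicalSpace M] [ChartedSpace (EuclideanSpace ℝ (Fin N)) M]
  [IsManifold (𝓡 N) ∞ M] [RiemannianBundle (fun x : M => TangentSpace (𝓡 N) x)]
  [MeasurableSpace M]

/-- Test functions, i.e. elements of `C_c^∞(M)`. -/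
def IsTestFun (N : ℕ) {M : Type*} [TopologicalSpace M]
    [ChartedSpace (EuclideanSpace ℝ (Fin N)) M] (φ : M → ℝ) : Prop :=
  ContMDiff (𝓡 N) 𝓘(ℝ, ℝ) ∞ φ ∧ HasCompactSupport φ

/-- `u` lies in the `L²` Sobolev space `W^{1,2}(M)` (the closure of the test functions, `M` being
complete) and `X` is its gradient: `(u, X)` is a limit in `L²(M) × L²(TM)` of pairs `(φ, ∇φ)` with
test functions `φ`. -/
def IsSobolevGrad (μ : Measure M) (u : M → ℝ) (X : VField N M) : Prop :=
  MemLp u 2 μ ∧ X.MemLp 2 μ ∧ ∃ φ : ℕ → M → ℝ, (∀ k, IsTestFun N (φ k)) ∧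
    Tendsto (fun k => eLpNorm (fun x => φ k x - u x) 2 μ) atTop (𝓝 0) ∧
    Tendsto (fun k => eLpNorm (fun x => ‖VField.grad (N := N) (φ k) x - X x‖) 2 μ) atTop (𝓝 0)

/-- `u` lies in the domain of the (nonnegative, self-adjoint) Laplace–Beltrami operator `Δ` of
`L²(M)`, with `∇u = X` and `Δu = h`. Thus `Δ` is the operator of the closed quadratic form
`∫ |∇u|² dμ` with domain `W^{1,2}(M)`. -/
def IsLaplacian (μ : Measure M) (u : M → ℝ) (X : VField N M) (h : M → ℝ) : Prop :=
  IsSobolevGrad μ u X ∧ MemLp h 2 μ ∧ ∀ φ : M → ℝ, IsTestFun N φ →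
    ∫ x, inner ℝ (X x) (VField.grad (N := N) φ x) ∂μ = ∫ x, h x * φ x ∂μ

/-- `u = (1 + tΔ)⁻¹ f` and `X = ∇u`, for `f ∈ L²(M)`. -/
def IsResolvent (μ : Measure M) (t : ℝ) (f u : M → ℝ) (X : VField N M) : Prop :=
  ∃ h : M → ℝ, IsLaplacian μ u X h ∧ ∀ᵐ x ∂μ, u x + t * h x = f x

/-- `X = ∇ (1 + tΔ)^{-m} f` for `f ∈ L²(M)` and `1 ≤ m`. (For `m = 0` it is never satisfied.) -/
def IsGradResolventPow (μ : Measure M) (t : ℝ) : ℕ → (M → ℝ) → VField N M → Prop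
  | 0, _, _ => False
  | 1, f, X => ∃ u, IsResolvent μ t f u X
  | m + 2, f, X => ∃ u Y, IsResolvent (N := N) μ t f u Y ∧ IsGradResolventPow μ t (m + 1) u X

/-- `g` is the vertical maximal function
`M_m^{res,∇} f = sup_{t > 0} |√t ∇ (1 + tΔ)^{-m} f|` of `f ∈ L²(M)`. As each of the functions
`|√t ∇ (1 + tΔ)^{-m} f|` is defined up to a null set only, the supremum over the uncountable set of
all `t > 0` is the supremum in the lattice of (classes of) measurable functions, i.e. the least
measurable function that dominates each of them almost everywhere. -/
def IsVerticalMaximal (N : ℕ) {M : Type*} [TopologicalSpace M]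
    [ChartedSpace (EuclideanSpace ℝ (Fin N)) M]
    [IsManifold (𝓡 N) ∞ M] [RiemannianBundle (fun x : M => TangentSpace (𝓡 N) x)]
    [MeasurableSpace M] (μ : Measure M) (m : ℕ) (f : M → ℝ) (g : M → ℝ≥0∞) : Prop :=
  ∃ X : ℝ → VField N M, (∀ t, 0 < t → IsGradResolventPow μ t m f (X t)) ∧ AEMeasurable g μ ∧
    (∀ t, 0 < t → ∀ᵐ x ∂μ, ENNReal.ofReal ‖√t • X t x‖ ≤ g x) ∧
    ∀ g' : M → ℝ≥0∞, AEMeasurable g' μ →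
      (∀ t, 0 < t → ∀ᵐ x ∂μ, ENNReal.ofReal ‖√t • X t x‖ ≤ g' x) → ∀ᵐ x ∂μ, g x ≤ g' x

/-- The Fefferman–Stein inequality
`‖(∑ᵢ (M_m^{res,∇} fᵢ)²)^{1/2}‖_p ≤ A ‖(∑ᵢ |fᵢ|²)^{1/2}‖_p`
for the vertical maximal function, for all sequences in (the dense subspace `L² ∩ L^p` of) `L^p`. -/
def FeffermanStein (N : ℕ) {M : Type*} [TopologicalSpace M]
    [ChartedSpace (EuclideanSpace ℝ (Fin N)) M]
    [IsManifold (𝓡 N) ∞ M] [RiemannianBundle (fun x : M => TangentSpace (𝓡 N) x)]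
    [MeasurableSpace M] (μ : Measure M) (m : ℕ) (p : ℝ≥0∞) : Prop :=
  ∃ A : ℝ≥0, 0 < A ∧ ∀ (f : ℕ → M → ℝ) (g : ℕ → M → ℝ≥0∞),
    (∀ i, MemLp (f i) 2 μ) → (∀ i, MemLp (f i) p μ) →
    (∀ i, IsVerticalMaximal N μ m (f i) (g i)) →
    eLpNorm (fun x => (∑' i, g i x ^ 2) ^ (1 / 2 : ℝ)) p μ
      ≤ A * eLpNorm (fun x => (∑' i, ENNReal.ofReal |f i x| ^ 2) ^ (1 / 2 : ℝ)) p μ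

variable [IsContMDiffRiemannianBundle (𝓡 N) ∞ (EuclideanSpace ℝ (Fin N))
    (fun x : M => TangentSpace (𝓡 N) x)] [SecondCountableTopology M] [BorelSpace M]

/-- The bounded operator `T : L^p(M) → L^p(TM)` is `√t ∇ (1 + tΔ)^{-m}`, i.e. it is the continuous
extension of this operator from the dense subspace `L² ∩ L^p` of `L^p(M)`. -/
def IsVerticalResolvent (μ : Measure M) (m : ℕ) (t : ℝ) {p : ℝ≥0∞} [Fact (1 ≤ p)]
    (T : Lp ℝ p μ →L[ℝ] LpVField N M p μ) : Prop :=
  ∀ (f : M → ℝ) (hf : MemLp f p μ), MemLp f 2 μ → ∃ X : VField N M,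
    IsGradResolventPow μ t m f X ∧
      ∃ hX : VField.MemLp (N := N) (√t • X) p μ, T (hf.toLp f) = hX.toLp

end Laplacian

/-! ### Manifolds with ends -/

/-- The Riemannian manifold `M` is a connected sum of the products `ℝ^{n i} × F i`: outside a
compact set `K` with nonempty interior, `M` is the disjoint union of open sets `E i`, each of which
is isometric, through `Φ i`, to the complement of a compact set `C i` in `ℝ^{n i} × F i` with the
product metric. -/
def IsConnectedSum (N : ℕ) (M : Type*) [TopologicalSpace M]
    [ChartedSpace (EuclideanSpace ℝ (Fin N)) M]
    [RiemannianBundle (fun x : M => TangentSpace (𝓡 N) x)]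
    {l : ℕ} (n k : Fin l → ℕ) (F : Fin l → Type*) [∀ i, TopologicalSpace (F i)]
    [∀ i, ChartedSpace (EuclideanSpace ℝ (Fin (k i))) (F i)]
    [∀ i, RiemannianBundle (fun y : F i => TangentSpace (𝓡 (k i)) y)] : Prop :=
  ∃ (K : Set M) (E : Fin l → Set M) (C : ∀ i, Set (EuclideanSpace ℝ (Fin (n i)) × F i))
    (Φ : ∀ i, EuclideanSpace ℝ (Fin (n i)) × F i → M),
    IsCompact K ∧ (interior K).Nonempty ∧ (∀ i, IsOpen (E i)) ∧
    (∀ i j, i ≠ j → Disjoint (E i) (E j)) ∧ Kᶜ = ⋃ i, E i ∧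
    ∀ i, IsCompact (C i) ∧
      ContMDiffOn ((𝓡 (n i)).prod (𝓡 (k i))) (𝓡 N) ∞ (Φ i) (C i)ᶜ ∧
      InjOn (Φ i) (C i)ᶜ ∧ Φ i '' (C i)ᶜ = E i ∧
      ∀ z ∈ (C i)ᶜ, ∀ (v : EuclideanSpace ℝ (Fin (n i))) (w : TangentSpace (𝓡 (k i)) z.2),
        ‖mfderiv ((𝓡 (n i)).prod (𝓡 (k i))) (𝓡 N) (Φ i) z (v, w)‖ ^ 2 = ‖v‖ ^ 2 + ‖w‖ ^ 2

end

/-! The maximal function dominates $|\sqrt t\,\nabla(1+t\Delta)^{-m}f|$ almost everywhere for each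
single $t$. Hence the Fefferman–Stein inequality, applied to $f_1,\dots,f_J$ and zeros, gives for
arbitrary $t_1,\dots,t_J$ the square function estimate $\|(\sum_j|T_{t_j}f_j|^2)^{1/2}\|_p\le
A\|(\sum_j|f_j|^2)^{1/2}\|_p$ on $L^2\cap L^p$, where $T_t=\sqrt t\,\nabla(1+t\Delta)^{-m}$
(`FeffermanStein.exists_square_function`). For $J=1$ this is a bound uniform in $t$, so each $T_t$
extends to $L^p$. For finite $p$, Khintchine's inequality compares square functions with randomized
sums on both sides (`eLpNorm_square_le_randNorm`, `exists_randNorm_le_eLpNorm_square`), and the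
estimate becomes R-boundedness (`RBounded.of_square_function`).

Three constructions make this argument applicable. A measurable orthonormal frame
(`exists_isMeasurableFrame`) identifies vector fields isometrically with $\mathbb R^N$-valued
functions, where Khintchine is used coordinate by coordinate. The resolvent is an orthogonal
projection in $L^2\oplus L^2$: projecting $(f,0)$ to the closure of the pairs $(\varphi,\sqrt
t\,\nabla\varphi)$ gives $(u,\sqrt t\,\nabla u)$ with $u=(1+t\Delta)^{-1}f$
(`IsMeasurableFrame.isResolvent_of_orthogonal`). The hypothesis speaks only of functions that are
maximal functions, so their existence as essential suprema of uncountable families has to be shown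
(`exists_ae_isLUB`). Local finiteness of the Riemannian measure supplies $\sigma$-finiteness and the
integrability of test functions and their gradients. -/

/-! ### Sums with random signs -/

/-- The sign `±1` encoded by a Boolean. -/
noncomputable def boolSign (b : Bool) : ℝ := if b then 1 else -1

/-- The signed sum `∑ⱼ ± xⱼ`. -/
noncomputable def signSum {J : ℕ} {X : Type*} [AddCommGroup X] [Module ℝ X] (σ : Fin J → Bool)
    (x : Fin J → X) : X :=
  ∑ j, boolSign (σ j) • x j

theorem signSum_smul {J : ℕ} (σ : Fin J → Bool) (c : ℝ) (x : Fin J → ℝ) :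
    signSum σ (fun j => c * x j) = c * signSum σ x := by
  simp only [signSum, smul_eq_mul, Finset.mul_sum]
  exact Finset.sum_congr rfl fun j _ => by ring

theorem map_signSum {J : ℕ} {X Y F : Type*} [AddCommGroup X] [Module ℝ X] [AddCommGroup Y]
    [Module ℝ Y] [FunLike F X Y] [LinearMapClass F ℝ X Y] (T : F) (σ : Fin J → Bool)
    (x : Fin J → X) : T (signSum σ x) = signSum σ (fun j => T (x j)) := by
  simp [signSum, map_sum, map_smul]

/-- Splitting off the first sign is the induction step for both the second and the exponential
moments. -/
theorem sum_signSum_succ {J : ℕ} {X : Type*} [AddCommGroup X] [Module ℝ X] (F : X → ℝ)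
    (a : Fin (J + 1) → X) :
    ∑ σ : Fin (J + 1) → Bool, F (signSum σ a)
      = ∑ σ : Fin J → Bool, (F (a 0 + signSum σ fun j => a j.succ)
          + F (-a 0 + signSum σ fun j => a j.succ)) := by
  rw [← (Fin.consEquiv fun _ : Fin (J + 1) => Bool).sum_comp, Fintype.sum_prod_type,
    Fintype.sum_bool, ← Finset.sum_add_distrib]
  refine Finset.sum_congr rfl fun σ _ => ?_
  simp [signSum, Fin.sum_univ_succ, Fin.consEquiv, boolSign]

theorem sum_signSum_sq {J : ℕ} (a : Fin J → ℝ) :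
    ∑ σ : Fin J → Bool, signSum σ a ^ 2 = 2 ^ J * ∑ j, a j ^ 2 := by
  induction J with
  | zero => simp [signSum]
  | succ J ih =>
    rw [sum_signSum_succ (fun x => x ^ 2)]
    have h : ∀ σ : Fin J → Bool, (a 0 + signSum σ fun j => a j.succ) ^ 2
        + (-a 0 + signSum σ fun j => a j.succ) ^ 2
        = 2 * a 0 ^ 2 + 2 * (signSum σ fun j => a j.succ) ^ 2 := fun σ => by ring
    simp only [h, Finset.sum_add_distrib, ← Finset.mul_sum, ih, Fin.sum_univ_succ]
    simp
    ring

/-- Sub-Gaussian bound: by independence each sign contributes a factor $\cosh a_j\le e^{a_j^2/2}$ to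
the mean. -/
theorem sum_exp_signSum_le {J : ℕ} (a : Fin J → ℝ) :
    ∑ σ : Fin J → Bool, Real.exp (signSum σ a) ≤ 2 ^ J * Real.exp ((∑ j, a j ^ 2) / 2) := by
  induction J with
  | zero => simp [signSum]
  | succ J ih =>
    rw [sum_signSum_succ Real.exp]
    have h : ∀ σ : Fin J → Bool, Real.exp (a 0 + signSum σ fun j => a j.succ)
        + Real.exp (-a 0 + signSum σ fun j => a j.succ)
        = 2 * Real.cosh (a 0) * Real.exp (signSum σ fun j => a j.succ) := fun σ => by
      rw [Real.exp_add, Real.exp_add, Real.cosh_eq]; ring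
    simp only [h, ← Finset.mul_sum, Fin.sum_univ_succ]
    calc 2 * Real.cosh (a 0) * ∑ σ : Fin J → Bool, Real.exp (signSum σ fun j => a j.succ)
        ≤ 2 * Real.exp (a 0 ^ 2 / 2) * (2 ^ J * Real.exp ((∑ j : Fin J, a j.succ ^ 2) / 2)) := by
          gcongr
          · exact Real.cosh_le_exp_half_sq _
          · exact ih _
      _ = _ := by rw [add_div, Real.exp_add]; ring

/-- The constant in the moment bound for sums with random signs. -/
noncomputable def signMomentConst (n : ℕ) : ℝ := n.factorial * (2 * Real.exp (1 / 2))

theorem one_le_signMomentConst (n : ℕ) : 1 ≤ signMomentConst n := by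
  have h1 : (1 : ℝ) ≤ n.factorial := by exact_mod_cast n.factorial_pos
  have h2 : (1 : ℝ) ≤ Real.exp (1 / 2) := Real.one_le_exp (by norm_num)
  unfold signMomentConst
  nlinarith

/-- **Khintchine's inequality**, upper bound for the moments. -/
theorem sum_abs_signSum_pow_le {J : ℕ} (n : ℕ) (a : Fin J → ℝ) :
    ∑ σ : Fin J → Bool, |signSum σ a| ^ n
      ≤ 2 ^ J * signMomentConst n * √(∑ j, a j ^ 2) ^ n := by
  have hR2 : √(∑ j, a j ^ 2) ^ 2 = ∑ j, a j ^ 2 :=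
    Real.sq_sqrt (Finset.sum_nonneg fun _ _ => sq_nonneg _)
  have hR0 : 0 ≤ √(∑ j, a j ^ 2) := Real.sqrt_nonneg _
  generalize √(∑ j, a j ^ 2) = R at hR2 hR0 ⊢
  rcases hR0.eq_or_lt with h0 | h0
  · have ha : ∀ j, a j = 0 := fun j => by
      rw [← h0, zero_pow two_ne_zero, eq_comm,
        Finset.sum_eq_zero_iff_of_nonneg fun _ _ => sq_nonneg _] at hR2
      simpa using hR2 j (Finset.mem_univ _)
    have : ∀ σ : Fin J → Bool, |signSum σ a| ^ n = R ^ n := fun σ => by simp [signSum, ha, ← h0]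
    simp only [this, Finset.sum_const, Finset.card_univ, Fintype.card_pi, Fintype.card_bool,
      Finset.prod_const, Fintype.card_fin, nsmul_eq_mul]
    push_cast
    rw [mul_assoc]
    gcongr
    exact le_mul_of_one_le_left (by positivity) (one_le_signMomentConst n)
  -- After normalization to $\sum_j b_j^2=1$, with $s=\sum\pm b_j$, one has $|s|^n\le n!\,e^{|s|}\le
  -- n!\,(e^s+e^{-s})$. Both exponentials have mean at most $e^{1/2}$, which explains
  -- `signMomentConst`.
  · let b : Fin J → ℝ := fun j => R⁻¹ * a j
    have hb : ∑ j, b j ^ 2 = 1 := by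
      simp only [b, mul_pow, ← Finset.mul_sum, ← hR2]
      field_simp
    have hb' : ∑ j, (-1 * b j) ^ 2 = 1 := by simpa using hb
    have hS : ∀ σ, signSum σ a = R * signSum σ b := fun σ => by
      rw [← signSum_smul]; congr; ext j; simp only [b]; field_simp
    have key : ∀ σ : Fin J → Bool, |signSum σ a| ^ n
        ≤ R ^ n * n.factorial * (Real.exp (signSum σ b) + Real.exp (signSum σ fun j => -1 * b j)) := by
      intro σ
      rw [hS, abs_mul, mul_pow, abs_of_pos h0, mul_assoc]
      gcongr
      have h1 : |signSum σ b| ^ n / n.factorial ≤ Real.exp |signSum σ b| :=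
        Real.pow_div_factorial_le_exp _ (abs_nonneg _) n
      rw [div_le_iff₀ (by positivity), mul_comm] at h1
      refine h1.trans ?_
      gcongr
      rw [signSum_smul σ (-1) b]
      rcases abs_cases (signSum σ b) with ⟨h, _⟩ | ⟨h, _⟩ <;> rw [h]
      · linarith [Real.exp_pos (-1 * signSum σ b)]
      · rw [neg_one_mul]; linarith [Real.exp_pos (signSum σ b)]
    calc ∑ σ : Fin J → Bool, |signSum σ a| ^ n
        ≤ ∑ σ : Fin J → Bool, R ^ n * n.factorial *
            (Real.exp (signSum σ b) + Real.exp (signSum σ fun j => -1 * b j)) :=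
          Finset.sum_le_sum fun σ _ => key σ
      _ = R ^ n * n.factorial * (∑ σ : Fin J → Bool, Real.exp (signSum σ b)
            + ∑ σ : Fin J → Bool, Real.exp (signSum σ fun j => -1 * b j)) := by
          rw [← Finset.mul_sum, Finset.sum_add_distrib]
      _ ≤ R ^ n * n.factorial * (2 ^ J * Real.exp (1 / 2) + 2 ^ J * Real.exp (1 / 2)) := by
          have h1 := sum_exp_signSum_le b
          have h2 := sum_exp_signSum_le fun j => -1 * b j
          rw [hb] at h1
          rw [hb'] at h2
          gcongr
      _ = _ := by unfold signMomentConst; ring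

/-- **Khintchine's inequality**, lower bound for the first moment. -/
theorem sqrt_sum_sq_le_sum_abs_signSum {J : ℕ} (a : Fin J → ℝ) :
    2 ^ J * √(∑ j, a j ^ 2)
      ≤ 2 * signMomentConst 4 * ∑ σ : Fin J → Bool, |signSum σ a| := by
  set R := √(∑ j, a j ^ 2) with hR
  set c := signMomentConst 4 with hc
  have hc1 : 1 ≤ c := one_le_signMomentConst 4
  have hR2 : R ^ 2 = ∑ j, a j ^ 2 := Real.sq_sqrt (Finset.sum_nonneg fun _ _ => sq_nonneg _)
  have h2 := sum_signSum_sq a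
  have h4 := sum_abs_signSum_pow_le 4 a
  rw [← hR2] at h2
  rw [← hR, ← hc] at h4
  have hR0 : 0 ≤ R := Real.sqrt_nonneg _
  -- With $k=cR$ and $w=|s|$ this is $k^2w^2\le k^3w+\frac4{27}w^4$; the difference of the two sides
  -- is $\frac4{27}w(w-\frac32k)^2(w+3k)$. Summed over the signs, the exactly known second moment is
  -- bounded by the first and fourth moments. Since $c\ge1$, the fourth-moment term is at most
  -- $\frac4{27}$ of the left side and is absorbed.
  have key : ∀ σ : Fin J → Bool, c ^ 2 * R ^ 2 * signSum σ a ^ 2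
      ≤ c ^ 3 * R ^ 3 * |signSum σ a| + 4 / 27 * |signSum σ a| ^ 4 := by
    intro σ
    rw [← sq_abs (signSum σ a)]
    have hw := abs_nonneg (signSum σ a)
    set w := |signSum σ a|
    have : 0 ≤ w * (4 / 27 * ((w - 3 / 2 * (c * R)) ^ 2 * (w + 3 * (c * R)))) := by positivity
    nlinarith
  have hsum := Finset.sum_le_sum fun σ (_ : σ ∈ Finset.univ) => key σ
  rw [Finset.sum_add_distrib, ← Finset.mul_sum, ← Finset.mul_sum, ← Finset.mul_sum, h2] at hsum
  set A := ∑ σ : Fin J → Bool, |signSum σ a|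
  have hA : 0 ≤ A := Finset.sum_nonneg fun _ _ => abs_nonneg _
  rcases hR0.eq_or_lt with h0 | h0
  · rw [← h0, mul_zero]; positivity
  · have h5 : c ^ 2 * (2 ^ J * R ^ 4) - 4 / 27 * (c * (2 ^ J * R ^ 4)) ≤ c ^ 3 * R ^ 3 * A := by
      nlinarith
    have h6 : (0 : ℝ) ≤ 2 ^ J * R ^ 4 := by positivity
    have h7 : c * (2 ^ J * R ^ 4) ≤ c ^ 2 * (2 ^ J * R ^ 4) := by
      gcongr; nlinarith
    have h8 : (c ^ 2 * R ^ 3) * (2 ^ J * R) ≤ (c ^ 2 * R ^ 3) * (2 * c * A) := by nlinarith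
    exact le_of_mul_le_mul_left h8 (by positivity)

/-- Khintchine's inequality for vectors of a Euclidean space, upper bound for the moments. -/
theorem sum_norm_signSum_pow_le {J N : ℕ} {n : ℕ} (hn : 1 ≤ n)
    (v : Fin J → EuclideanSpace ℝ (Fin N)) :
    ∑ σ : Fin J → Bool, ‖signSum σ v‖ ^ n
      ≤ 2 ^ J * (N ^ n * signMomentConst n) * √(∑ j, ‖v j‖ ^ 2) ^ n := by
  have hcoord : ∀ σ (i : Fin N), signSum σ v i = signSum σ fun j => v j i := fun σ i => by
    simp [signSum, smul_eq_mul]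
  have h1 : ∀ σ, ‖signSum σ v‖ ≤ ∑ i, |signSum σ fun j => v j i| := fun σ => by
    have := (EuclideanSpace.basisFun (Fin N) ℝ).sum_repr (signSum σ v)
    conv_lhs => rw [← this]
    refine (norm_sum_le _ _).trans (Finset.sum_le_sum fun i _ => ?_)
    simp [norm_smul, hcoord]
  -- The power mean inequality costs $N^{n-1}$; the sum over the $N$ coordinates later contributes
  -- the missing factor $N$.
  have h2 : ∀ σ, ‖signSum σ v‖ ^ n
      ≤ (N : ℝ) ^ (n - 1) * ∑ i, |signSum σ fun j => v j i| ^ n := fun σ => by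
    obtain ⟨k, rfl⟩ := Nat.exists_eq_add_of_le' hn
    rcases Nat.eq_zero_or_pos N with rfl | hN
    · have := h1 σ
      simp only [Finset.univ_eq_empty, Finset.sum_empty] at this
      simp [le_antisymm this (norm_nonneg _)]
    calc ‖signSum σ v‖ ^ (k + 1) ≤ (∑ i, |signSum σ fun j => v j i|) ^ (k + 1) := by
          gcongr; exact h1 σ
      _ ≤ _ := by
          have := pow_sum_div_card_le_sum_pow (s := Finset.univ)
            (f := fun i => |signSum σ fun j => v j i|) (fun i _ => abs_nonneg _) k
          rwa [div_le_iff₀ (by simp; positivity), mul_comm, Finset.card_univ, Fintype.card_fin]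
            at this
  have h3 : ∀ i, ∑ σ : Fin J → Bool, |signSum σ fun j => v j i| ^ n
      ≤ 2 ^ J * signMomentConst n * √(∑ j, ‖v j‖ ^ 2) ^ n := fun i => by
    refine (sum_abs_signSum_pow_le n _).trans ?_
    have := one_le_signMomentConst n
    refine mul_le_mul_of_nonneg_left (pow_le_pow_left₀ (Real.sqrt_nonneg _)
      (Real.sqrt_le_sqrt (Finset.sum_le_sum fun j _ => ?_)) n) (by positivity)
    rw [EuclideanSpace.real_norm_sq_eq (v j)]
    exact Finset.single_le_sum (f := fun i => v j i ^ 2) (fun _ _ => sq_nonneg _)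
      (Finset.mem_univ i)
  calc ∑ σ : Fin J → Bool, ‖signSum σ v‖ ^ n
      ≤ ∑ σ : Fin J → Bool, (N : ℝ) ^ (n - 1) * ∑ i, |signSum σ fun j => v j i| ^ n :=
        Finset.sum_le_sum fun σ _ => h2 σ
    _ = (N : ℝ) ^ (n - 1) * ∑ i, ∑ σ : Fin J → Bool, |signSum σ fun j => v j i| ^ n := by
        rw [← Finset.mul_sum, Finset.sum_comm]
    _ ≤ (N : ℝ) ^ (n - 1) * ∑ _i : Fin N,
          2 ^ J * signMomentConst n * √(∑ j, ‖v j‖ ^ 2) ^ n := by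
        gcongr with i; exact h3 i
    _ = _ := by
        obtain ⟨k, rfl⟩ := Nat.exists_eq_add_of_le' hn
        simp [pow_succ]
        ring

/-- **Minkowski's integral inequality** for finitely many functions. -/
theorem lintegral_rpow_sum_le {α ι : Type*} [MeasurableSpace α] {μ : Measure α} [Fintype ι]
    {H : ι → α → ℝ≥0∞} (hH : ∀ i, AEMeasurable (H i) μ) {s : ℝ} (hs : 1 ≤ s) :
    (∑ i, (∫⁻ x, H i x ∂μ) ^ s) ^ (1 / s) ≤ ∫⁻ x, (∑ i, H i x ^ s) ^ (1 / s) ∂μ := by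
  rcases hs.eq_or_lt with rfl | hs1
  · simp [lintegral_finsetSum' _ fun i _ => hH i]
  have hs0 : 0 < s := by linarith
  set I : ι → ℝ≥0∞ := fun i => ∫⁻ x, H i x ∂μ with hI
  set B := ∫⁻ x, (∑ i, H i x ^ s) ^ (1 / s) ∂μ with hB
  by_cases htop : ∃ i, I i = ⊤
  · obtain ⟨i, hi⟩ := htop
    have : I i ≤ B := lintegral_mono fun x => by
      calc H i x = (H i x ^ s) ^ (1 / s) := by
            rw [← ENNReal.rpow_mul, mul_one_div_cancel hs0.ne', ENNReal.rpow_one]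
        _ ≤ _ := by
            gcongr
            exact Finset.single_le_sum (f := fun i => H i x ^ s) (fun _ _ => zero_le)
              (Finset.mem_univ i)
    rw [hi, top_le_iff] at this
    simp [this]
  push Not at htop
  set A := ∑ i, I i ^ s with hA
  have hAtop : A ≠ ⊤ := ENNReal.sum_ne_top.2 fun i _ => ENNReal.rpow_ne_top_of_nonneg hs0.le (htop i)
  by_cases hA0 : A = 0
  · simp [hA0, hs0]
  have hconj : (s / (s - 1)).HolderConjugate s := (Real.HolderConjugate.conjExponent hs1).symm
  -- Duality argument: $A=\int\sum_i I_i^{s-1}H_i$, and Hölder in $i$ with exponents $s/(s-1)$ and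
  -- $s$ extracts the factor $A^{1-1/s}$. Dividing by it requires $0<A<\infty$, whence the preceding
  -- case distinctions.
  have hmain : A ≤ A ^ (1 / (s / (s - 1))) * B := by
    calc A = ∑ i, ∫⁻ x, I i ^ (s - 1) * H i x ∂μ := by
          refine Finset.sum_congr rfl fun i _ => ?_
          rw [lintegral_const_mul'' _ (hH i)]
          change _ = I i ^ (s - 1) * I i
          conv_lhs => rw [show s = (s - 1) + 1 by ring]
          rw [ENNReal.rpow_add_of_nonneg _ _ (by linarith) zero_le_one, ENNReal.rpow_one]
      _ = ∫⁻ x, ∑ i, I i ^ (s - 1) * H i x ∂μ :=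
          (lintegral_finsetSum' _ fun i _ => (hH i).const_mul _).symm
      _ ≤ ∫⁻ x, A ^ (1 / (s / (s - 1))) * (∑ i, H i x ^ s) ^ (1 / s) ∂μ := by
          refine lintegral_mono fun x => ?_
          refine (ENNReal.inner_le_Lp_mul_Lq _ _ _ hconj).trans_eq ?_
          have : ∀ i, (I i ^ (s - 1)) ^ (s / (s - 1)) = I i ^ s := fun i => by
            rw [← ENNReal.rpow_mul]
            congr 1
            have : s - 1 ≠ 0 := by linarith
            field_simp
          simp only [this, hA]
      _ = _ := lintegral_const_mul' _ _ (ENNReal.rpow_ne_top_of_nonneg (by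
          have : 0 < s - 1 := by linarith
          positivity) hAtop)
  have hq : A ^ (1 / (s / (s - 1))) ≠ 0 := by simp [hA0, hAtop]
  have hq' : A ^ (1 / (s / (s - 1))) ≠ ⊤ := ENNReal.rpow_ne_top_of_ne_zero hA0 hAtop
  rw [mul_comm, ← ENNReal.div_le_iff hq hq'] at hmain
  refine le_trans (le_of_eq ?_) hmain
  have hsum := hconj.inv_add_inv_eq_one
  conv_rhs => enter [1]; rw [← ENNReal.rpow_one A]
  rw [← ENNReal.rpow_sub _ _ hA0 hAtop]
  congr 1
  simp only [one_div] at *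
  linarith

/-- The second moment norm `(E‖∑ⱼ εⱼ xⱼ‖²)^{1/2}` of a sum with random signs. -/
noncomputable def randNorm {X : Type*} [NormedAddCommGroup X] [NormedSpace ℝ X] {J : ℕ}
    (x : Fin J → X) : ℝ≥0∞ :=
  (∑ σ : Fin J → Bool, (2 ^ J : ℝ≥0∞)⁻¹ * ‖signSum σ x‖ₑ ^ (2 : ℝ)) ^ (1 / 2 : ℝ)

theorem sum_signWeight (J : ℕ) : ∑ _σ : Fin J → Bool, (2 ^ J : ℝ≥0∞)⁻¹ = 1 := by
  simp only [Finset.sum_const, Finset.card_univ, Fintype.card_pi, Fintype.card_bool,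
    Finset.prod_const, Fintype.card_fin, nsmul_eq_mul]
  push_cast
  exact ENNReal.mul_inv_cancel (by simp) (by simp)

/-! ### Khintchine's inequality in $L^p$ -/

section Khintchine

variable {α : Type*} [MeasurableSpace α] {μ : Measure α} {p : ℝ≥0∞}

theorem coeFn_signSum {E : Type*} [NormedAddCommGroup E] [NormedSpace ℝ E] {J : ℕ}
    (σ : Fin J → Bool) (y : Fin J → Lp E p μ) :
    ⇑(signSum σ y : Lp E p μ) =ᵐ[μ] fun a => signSum σ fun j => y j a := by
  have h1 := Lp.coeFn_finsetSum (μ := μ) (p := p) Finset.univ (fun j => boolSign (σ j) • y j)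
  have h2 : ∀ᵐ a ∂μ, ∀ j, (boolSign (σ j) • y j : Lp E p μ) a = boolSign (σ j) • y j a :=
    ae_all_iff.2 fun j => Lp.coeFn_smul _ _
  filter_upwards [h1, h2] with a h1 h2
  unfold signSum
  rw [h1]
  simp [h2]

theorem enorm_signSum_eq {E : Type*} [NormedAddCommGroup E] [NormedSpace ℝ E] {J : ℕ}
    (σ : Fin J → Bool) (y : Fin J → Lp E p μ) :
    ‖signSum σ y‖ₑ = eLpNorm (fun a => signSum σ fun j => y j a) p μ := by
  rw [Lp.enorm_def, eLpNorm_congr_ae (coeFn_signSum σ y)]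

/-- The `L^p` norm of the square function is dominated by the norm of the randomized sum. -/
theorem eLpNorm_square_le_randNorm [Fact (1 ≤ p)] {J : ℕ} (x : Fin J → Lp ℝ p μ) :
    eLpNorm (fun a => √(∑ j, (x j a) ^ 2)) p μ
      ≤ ENNReal.ofReal (2 * signMomentConst 4) * randNorm x := by
  have hp : 1 ≤ p := Fact.out
  have hF : ∀ σ, AEStronglyMeasurable (fun a => signSum σ fun j => x j a) μ := fun σ =>
    (Lp.aestronglyMeasurable (signSum σ x)).congr (coeFn_signSum σ x)
  have hc0 : 0 ≤ 2 * signMomentConst 4 := by linarith [one_le_signMomentConst 4]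
  -- The lower Khintchine bound is applied at each point. The triangle inequality in $L^p$ then
  -- moves the average over signs outside the norm, and Jensen passes from the first to the second
  -- moment.
  have h1 : eLpNorm (fun a => √(∑ j, (x j a) ^ 2)) p μ ≤
      eLpNorm ((2 * signMomentConst 4 * (2 ^ J)⁻¹) •
        ∑ σ : Fin J → Bool, fun a => ‖signSum σ fun j => x j a‖) p μ := by
    refine eLpNorm_mono_real fun a => ?_
    have := sqrt_sum_sq_le_sum_abs_signSum fun j => x j a
    simp only [Pi.smul_apply, Finset.sum_apply, smul_eq_mul, Real.norm_eq_abs]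
    rw [abs_of_nonneg (Real.sqrt_nonneg _), mul_right_comm, ← div_eq_mul_inv, le_div_iff₀ (by positivity)]
    linarith
  refine h1.trans ?_
  rw [eLpNorm_const_smul]
  have h2 : ‖2 * signMomentConst 4 * ((2 : ℝ) ^ J)⁻¹‖ₑ
      = ENNReal.ofReal (2 * signMomentConst 4) * (2 ^ J)⁻¹ := by
    rw [enorm_mul, Real.enorm_of_nonneg hc0, enorm_inv (by positivity), enorm_pow]
    simp [Real.enorm_of_nonneg]
  rw [h2, mul_assoc]
  gcongr
  calc (2 ^ J : ℝ≥0∞)⁻¹ * eLpNorm (∑ σ : Fin J → Bool, fun a => ‖signSum σ fun j => x j a‖) p μ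
      ≤ (2 ^ J : ℝ≥0∞)⁻¹ * ∑ σ : Fin J → Bool, ‖signSum σ x‖ₑ := by
        gcongr
        refine (eLpNorm_sum_le (fun σ _ => (hF σ).norm) hp).trans_eq ?_
        refine Finset.sum_congr rfl fun σ _ => ?_
        rw [eLpNorm_norm, enorm_signSum_eq]
    _ = ((∑ σ : Fin J → Bool, (2 ^ J : ℝ≥0∞)⁻¹ * ‖signSum σ x‖ₑ) ^ (2 : ℝ)) ^ (1 / 2 : ℝ) := by
        rw [← ENNReal.rpow_mul, Finset.mul_sum]; norm_num
    _ ≤ randNorm x := by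
        unfold randNorm
        gcongr
        exact ENNReal.rpow_arith_mean_le_arith_mean_rpow _ _ _ (sum_signWeight J) one_le_two

/-- The norm of a randomized sum is dominated by the `L^p` norm of the square function. -/
theorem exists_randNorm_le_eLpNorm_square (N : ℕ) [Fact (1 ≤ p)] (hp : p ≠ ⊤) :
    ∃ K : ℝ≥0, ∀ (J : ℕ) (y : Fin J → Lp (EuclideanSpace ℝ (Fin N)) p μ),
      randNorm y ≤ K * eLpNorm (fun a => √(∑ j, ‖y j a‖ ^ 2)) p μ := by
  have hp1 : 1 ≤ p := Fact.out
  have hp0 : p ≠ 0 := (zero_lt_one.trans_le hp1).ne'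
  -- An integer $n$, because the moment bounds are for integer powers; $n\ge p$ makes $n/p$ an
  -- admissible Minkowski exponent, and $n\ge2$ lets the $n$-th moment control the second.
  obtain ⟨n, hn⟩ := exists_nat_ge (max p.toReal 2)
  have hnp : p.toReal ≤ n := (le_max_left _ _).trans hn
  have hn2 : (2 : ℝ) ≤ n := (le_max_right _ _).trans hn
  have hn0 : (0 : ℝ) < n := by linarith
  have hpr : 0 < p.toReal := ENNReal.toReal_pos hp0 hp
  set r := p.toReal with hr
  set c : ℝ := (N : ℝ) ^ n * signMomentConst n with hc
  have hc0 : 0 ≤ c := by have := one_le_signMomentConst n; positivity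
  refine ⟨(c.toNNReal) ^ (1 / (n : ℝ)), fun J y => ?_⟩
  set R : α → ℝ := fun a => √(∑ j, ‖y j a‖ ^ 2) with hR
  set F : (Fin J → Bool) → α → EuclideanSpace ℝ (Fin N) := fun σ a => signSum σ fun j => y j a
    with hFdef
  have hF : ∀ σ, AEStronglyMeasurable (F σ) μ := fun σ =>
    (Lp.aestronglyMeasurable (signSum σ y)).congr (coeFn_signSum σ y)
  have hpt : ∀ a, ∑ σ, ‖F σ a‖ₑ ^ (n : ℝ) ≤ 2 ^ J * ENNReal.ofReal c * ‖R a‖ₑ ^ (n : ℝ) := fun a => by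
    have h := sum_norm_signSum_pow_le (n := n) (by exact_mod_cast (by linarith : (1 : ℝ) ≤ n))
      fun j => y j a
    have h' := ENNReal.ofReal_le_ofReal h
    rw [← hc, ENNReal.ofReal_sum_of_nonneg fun _ _ => by positivity, ENNReal.ofReal_mul (by positivity),
      ENNReal.ofReal_mul (by positivity), ENNReal.ofReal_pow (Real.sqrt_nonneg _)] at h'
    simp only [ENNReal.rpow_natCast]
    convert h' using 2 with σ
    · rw [ENNReal.ofReal_pow (norm_nonneg _), ofReal_norm]
    · simp [ENNReal.ofReal_pow]
    · rw [Real.enorm_of_nonneg (Real.sqrt_nonneg _)]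
  have hnorm : ∀ σ, ‖signSum σ y‖ₑ ^ (n : ℝ) = (∫⁻ a, ‖F σ a‖ₑ ^ r ∂μ) ^ (n / r) := fun σ => by
    rw [enorm_signSum_eq, eLpNorm_eq_lintegral_rpow_enorm_toReal hp0 hp, ← ENNReal.rpow_mul,
      ← hr, one_div_mul_eq_div]
  -- Minkowski with exponent $n/p$ brings the sum over signs under the integral, where the pointwise
  -- bound `hpt` applies.
  have hmink := lintegral_rpow_sum_le (μ := μ) (H := fun σ a => ‖F σ a‖ₑ ^ r)
    (fun σ => (hF σ).enorm.pow_const _) (s := n / r) ((one_le_div hpr).2 hnp)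
  have hsum : ∑ σ, ‖signSum σ y‖ₑ ^ (n : ℝ)
      ≤ 2 ^ J * ENNReal.ofReal c * eLpNorm R p μ ^ (n : ℝ) := by
    simp only [hnorm]
    have hmink' := ENNReal.rpow_le_rpow hmink (by positivity : 0 ≤ (n : ℝ) / r)
    rw [← ENNReal.rpow_mul, one_div_mul_cancel (by positivity), ENNReal.rpow_one] at hmink'
    refine hmink'.trans ?_
    have : ∀ a, (∑ σ, (‖F σ a‖ₑ ^ r) ^ (n / r)) ^ (1 / (n / r))
        ≤ (2 ^ J * ENNReal.ofReal c) ^ (r / n) * ‖R a‖ₑ ^ r := fun a => by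
      have e1 : ∀ σ, (‖F σ a‖ₑ ^ r) ^ (n / r) = ‖F σ a‖ₑ ^ (n : ℝ) := fun σ => by
        rw [← ENNReal.rpow_mul]; congr 1; field_simp
      simp only [e1, one_div_div]
      calc _ ≤ (2 ^ J * ENNReal.ofReal c * ‖R a‖ₑ ^ (n : ℝ)) ^ (r / n) := by
            gcongr; exact hpt a
        _ = _ := by
            rw [ENNReal.mul_rpow_of_nonneg _ _ (by positivity), ← ENNReal.rpow_mul]
            congr 2; field_simp
    calc (∫⁻ a, (∑ σ, (‖F σ a‖ₑ ^ r) ^ (n / r)) ^ (1 / (n / r)) ∂μ) ^ (n / r)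
        ≤ (∫⁻ a, (2 ^ J * ENNReal.ofReal c) ^ (r / n) * ‖R a‖ₑ ^ r ∂μ) ^ (n / r) := by
          gcongr with a; exact this a
      _ = _ := by
          rw [lintegral_const_mul' _ _ (ENNReal.rpow_ne_top_of_nonneg (by positivity)
              (by simp [ENNReal.mul_eq_top])), ENNReal.mul_rpow_of_nonneg _ _ (by positivity),
            ← ENNReal.rpow_mul, eLpNorm_eq_lintegral_rpow_enorm_toReal hp0 hp,
            ← ENNReal.rpow_mul]
          congr 2
          · rw [div_mul_div_cancel₀ hn0.ne', div_self hpr.ne', ENNReal.rpow_one]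
          · rw [← hr]; field_simp
  have hmean : (∑ σ : Fin J → Bool, (2 ^ J : ℝ≥0∞)⁻¹ * ‖signSum σ y‖ₑ ^ (2 : ℝ)) ^ ((n : ℝ) / 2)
      ≤ ENNReal.ofReal c * eLpNorm R p μ ^ (n : ℝ) := by
    refine (ENNReal.rpow_arith_mean_le_arith_mean_rpow _ _ _ (sum_signWeight J)
      (by linarith : 1 ≤ (n : ℝ) / 2)).trans ?_
    have e1 : ∀ σ, (‖signSum σ y‖ₑ ^ (2 : ℝ)) ^ ((n : ℝ) / 2) = ‖signSum σ y‖ₑ ^ (n : ℝ) :=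
      fun σ => by rw [← ENNReal.rpow_mul]; congr 1; field_simp
    simp only [e1]
    rw [← Finset.mul_sum]
    calc _ ≤ (2 ^ J : ℝ≥0∞)⁻¹ * (2 ^ J * ENNReal.ofReal c * eLpNorm R p μ ^ (n : ℝ)) := by
          gcongr
      _ = _ := by
          rw [mul_assoc, ← mul_assoc, ENNReal.inv_mul_cancel (by simp) (by simp), one_mul]
  calc randNorm y = ((∑ σ : Fin J → Bool, (2 ^ J : ℝ≥0∞)⁻¹ * ‖signSum σ y‖ₑ ^ (2 : ℝ))
          ^ ((n : ℝ) / 2)) ^ (1 / (n : ℝ)) := by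
        rw [← ENNReal.rpow_mul, randNorm]; congr 1; field_simp
    _ ≤ (ENNReal.ofReal c * eLpNorm R p μ ^ (n : ℝ)) ^ (1 / (n : ℝ)) := by gcongr
    _ = _ := by
        rw [ENNReal.mul_rpow_of_nonneg _ _ (by positivity), ← ENNReal.rpow_mul,
          mul_one_div_cancel hn0.ne', ENNReal.rpow_one,
          ENNReal.coe_rpow_of_nonneg _ (by positivity)]
        rfl

end Khintchine

/-! ### `R`-boundedness from square function estimates -/

section Rademacher

variable {S : Type} [MeasurableSpace S] {P : Measure S} {ε : ℕ → S → ℝ}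

theorem boolSign_injective : Function.Injective boolSign := by
  intro a b h
  cases a <;> cases b <;> simp_all [boolSign] <;> norm_num at h

theorem IsRademacherSequence.measure_preimage_boolSign (hε : IsRademacherSequence P ε) (j : ℕ)
    (b : Bool) : P (ε j ⁻¹' {boolSign b}) = 2⁻¹ := by
  cases b
  · simpa [boolSign] using! hε.prob_neg_one j
  · simpa [boolSign] using! hε.prob_one j

theorem IsRademacherSequence.measure_signs (hε : IsRademacherSequence P ε) {J : ℕ}
    (σ : Fin J → Bool) : P (⋂ j : Fin J, ε j ⁻¹' {boolSign (σ j)}) = (2 ^ J)⁻¹ := by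
  have hind : iIndepFun (fun j : Fin J => ε j) P := hε.indep.precomp Fin.val_injective
  have := hind.measure_inter_preimage_eq_mul Finset.univ
    (sets := fun j => {boolSign (σ j)}) fun j _ => measurableSet_singleton _
  simp only [Finset.mem_univ, iInter_true, hε.measure_preimage_boolSign, Finset.prod_const,
    Finset.card_univ, Fintype.card_fin] at this
  rw [this, ENNReal.inv_pow]

variable [IsProbabilityMeasure P]

theorem IsRademacherSequence.ae_eq_boolSign (hε : IsRademacherSequence P ε) :
    ∀ᵐ s ∂P, ∀ j, ∃ b, ε j s = boolSign b := by
  refine ae_all_iff.2 fun j => ?_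
  have hm : ∀ b, MeasurableSet (ε j ⁻¹' {boolSign b}) := fun b =>
    hε.measurable j (measurableSet_singleton _)
  have hd : Disjoint (ε j ⁻¹' {boolSign true}) (ε j ⁻¹' {boolSign false}) :=
    Disjoint.preimage _ (by simpa using fun h => by simpa using boolSign_injective h)
  have h1 : P (ε j ⁻¹' {boolSign true} ∪ ε j ⁻¹' {boolSign false}) = 1 := by
    rw [measure_union hd (hm _), hε.measure_preimage_boolSign, hε.measure_preimage_boolSign,
      ENNReal.inv_two_add_inv_two]
  have h2 := (prob_compl_eq_zero_iff ((hm true).union (hm false))).2 h1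
  filter_upwards [compl_mem_ae_iff.2 h2] with s hs
  simp only [compl_compl, mem_union, mem_preimage, mem_singleton_iff] at hs
  exact hs.elim (fun h => ⟨_, h⟩) fun h => ⟨_, h⟩

/-- The $2^J$ sign patterns split the probability space, up to a null set, into events of
probability $2^{-J}$. Thus the choice of Rademacher sequence is immaterial, and R-boundedness
reduces to finite averages. -/
theorem IsRademacherSequence.eLpNorm_sum (hε : IsRademacherSequence P ε) {X : Type*}
    [NormedAddCommGroup X] [NormedSpace ℝ X] {J : ℕ} (x : Fin J → X) :
    eLpNorm (fun s => ∑ j : Fin J, ε j s • x j) 2 P = randNorm x := by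
  set B : (Fin J → Bool) → Set S := fun σ => ⋂ j : Fin J, ε j ⁻¹' {boolSign (σ j)} with hB
  have hBm : ∀ σ, MeasurableSet (B σ) := fun σ =>
    MeasurableSet.iInter fun j => hε.measurable j (measurableSet_singleton _)
  have hae : (fun s => ‖∑ j : Fin J, ε j s • x j‖ₑ ^ (2 : ℝ)) =ᵐ[P]
      fun s => ∑ σ, (B σ).indicator (fun _ => ‖signSum σ x‖ₑ ^ (2 : ℝ)) s := by
    filter_upwards [hε.ae_eq_boolSign] with s hs
    choose b hb using hs
    rw [Finset.sum_eq_single (fun j : Fin J => b j)]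
    · rw [indicator_of_mem (by simp [hB, hb])]
      simp [signSum, hb]
    · intro σ _ hσ
      refine indicator_of_notMem (fun hmem => hσ ?_) _
      ext j
      simp only [hB, mem_iInter, mem_preimage, mem_singleton_iff] at hmem
      exact boolSign_injective ((hmem j).symm.trans (hb j))
    · simp
  rw [eLpNorm_eq_lintegral_rpow_enorm_toReal two_ne_zero ENNReal.ofNat_ne_top, randNorm]
  simp only [ENNReal.toReal_ofNat]
  rw [lintegral_congr_ae hae, lintegral_finsetSum _ fun σ _ => measurable_const.indicator (hBm σ)]
  congr 1
  refine Finset.sum_congr rfl fun σ _ => ?_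
  rw [lintegral_indicator_const (hBm σ), hε.measure_signs, mul_comm]

end Rademacher

theorem continuous_randNorm {X : Type*} [NormedAddCommGroup X] [NormedSpace ℝ X] {J : ℕ} :
    Continuous (randNorm : (Fin J → X) → ℝ≥0∞) := by
  unfold randNorm signSum
  refine ENNReal.continuous_rpow_const.comp (continuous_finsetSum _ fun σ _ => ?_)
  refine (ENNReal.continuous_const_mul (by simp)).comp (ENNReal.continuous_rpow_const.comp ?_)
  fun_prop

theorem randNorm_map_linearIsometry {X Y : Type*} [NormedAddCommGroup X] [NormedSpace ℝ X]
    [NormedAddCommGroup Y] [NormedSpace ℝ Y] (Ψ : X →ₗᵢ[ℝ] Y) {J : ℕ} (x : Fin J → X) :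
    randNorm (fun j => Ψ (x j)) = randNorm x := by
  unfold randNorm
  simp only [← map_signSum, Ψ.enorm_map]

theorem RBounded.of_randNorm_le {X Y : Type*} [NormedAddCommGroup X] [NormedSpace ℝ X]
    [NormedAddCommGroup Y] [NormedSpace ℝ Y] {𝒯 : Set (X →L[ℝ] Y)} (C : ℝ≥0)
    (h : ∀ (J : ℕ) (T : Fin J → X →L[ℝ] Y), (∀ j, T j ∈ 𝒯) → ∀ x : Fin J → X,
      randNorm (fun j => T j (x j)) ≤ C * randNorm x) : RBounded 𝒯 := by
  refine ⟨C, fun S _ P _ ε hε J T hT x => ?_⟩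
  rw [hε.eLpNorm_sum, hε.eLpNorm_sum]
  exact h J T hT x

/-- A family of bounded operators from `L^p` to a space that contains the vector-valued `L^p`
isometrically is `R`-bounded if it satisfies a square function estimate on a dense subset. -/
theorem RBounded.of_square_function {α : Type*} [MeasurableSpace α] {μ : Measure α} {p : ℝ≥0∞}
    [Fact (1 ≤ p)] (hp : p ≠ ⊤) {N : ℕ} {Y : Type*} [NormedAddCommGroup Y] [NormedSpace ℝ Y]
    (Ψ : Lp (EuclideanSpace ℝ (Fin N)) p μ →ₗᵢ[ℝ] Y) {ι : Type*}
    (S : ι → Lp ℝ p μ →L[ℝ] Lp (EuclideanSpace ℝ (Fin N)) p μ) {D : Set (Lp ℝ p μ)}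
    (hD : Dense D) (A : ℝ≥0)
    (hS : ∀ (J : ℕ) (i : Fin J → ι) (f : Fin J → Lp ℝ p μ), (∀ j, f j ∈ D) →
      eLpNorm (fun a => √(∑ j, ‖S (i j) (f j) a‖ ^ 2)) p μ
        ≤ A * eLpNorm (fun a => √(∑ j, (f j a) ^ 2)) p μ) :
    RBounded (range fun i => Ψ.toContinuousLinearMap.comp (S i)) := by
  obtain ⟨K, hK⟩ := exists_randNorm_le_eLpNorm_square (μ := μ) (p := p) N hp
  refine RBounded.of_randNorm_le (K * A * (2 * signMomentConst 4).toNNReal) fun J T hT x => ?_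
  choose i hi using hT
  have hT' : (fun j => T j (x j)) = fun j => Ψ (S (i j) (x j)) := by
    ext j; rw [← hi j]; rfl
  rw [hT', randNorm_map_linearIsometry]
  -- Both sides are continuous in the tuple, so it suffices to check tuples from the dense set,
  -- where the square function estimate is available.
  have hcl : IsClosed {x : Fin J → Lp ℝ p μ | randNorm (fun j => S (i j) (x j))
      ≤ (K * A * (2 * signMomentConst 4).toNNReal : ℝ≥0) * randNorm x} :=
    isClosed_le (continuous_randNorm.comp (by fun_prop))
      ((ENNReal.continuous_const_mul ENNReal.coe_ne_top).comp continuous_randNorm)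
  have hdense : Dense (univ.pi fun _ : Fin J => D) := dense_pi _ fun _ _ => hD
  refine hcl.closure_subset_iff.2 (fun y hy => ?_) (hdense x)
  have hy' : ∀ j, y j ∈ D := fun j => hy j (mem_univ j)
  calc randNorm (fun j => S (i j) (y j))
      ≤ K * eLpNorm (fun a => √(∑ j, ‖S (i j) (y j) a‖ ^ 2)) p μ := hK J _
    _ ≤ K * (A * (ENNReal.ofReal (2 * signMomentConst 4) * randNorm y)) := by
        gcongr
        exact (hS J i y hy').trans (by gcongr; exact eLpNorm_square_le_randNorm y)
    _ = _ := by
        push_cast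
        rw [mul_assoc, mul_assoc]
        rfl

/-! ### Local finiteness of the Riemannian measure -/

section LocallyFinite

attribute [local instance] normedAddCommGroupTangentSpaceVectorSpace
attribute [local instance] normedSpaceTangentSpaceVectorSpace

variable {N : ℕ} {M : Type*} [EMetricSpace M] [ChartedSpace (EuclideanSpace ℝ (Fin N)) M]
  [IsManifold (𝓡 N) ∞ M] [RiemannianBundle (fun x : M => TangentSpace (𝓡 N) x)]
  [IsContMDiffRiemannianBundle (𝓡 N) ∞ (EuclideanSpace ℝ (Fin N))
    (fun x : M => TangentSpace (𝓡 N) x)]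

theorem isContinuousRiemannianBundle_tangentSpace {N : ℕ} {M : Type*} [TopologicalSpace M]
    [ChartedSpace (EuclideanSpace ℝ (Fin N)) M] [IsManifold (𝓡 N) ∞ M]
    [RiemannianBundle (fun x : M => TangentSpace (𝓡 N) x)]
    [IsContMDiffRiemannianBundle (𝓡 N) ∞ (EuclideanSpace ℝ (Fin N))
      (fun x : M => TangentSpace (𝓡 N) x)] :
    IsContinuousRiemannianBundle (EuclideanSpace ℝ (Fin N))
      (fun x : M => TangentSpace (𝓡 N) x) := by
  obtain ⟨g, hg, hg'⟩ := IsContMDiffRiemannianBundle.exists_contMDiff (IB := 𝓡 N) (n := ∞)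
    (F := EuclideanSpace ℝ (Fin N)) (E := fun x : M => TangentSpace (𝓡 N) x)
  exact ⟨g, hg.continuous, hg'⟩

/-- The inverses of the charts of a Riemannian manifold are locally Lipschitz. -/
theorem exists_lipschitzOnWith_extChartAt_symm [IsRiemannianManifold (𝓡 N) M] (x : M) :
    ∃ (C : ℝ≥0) (r : ℝ), 0 < r ∧
      Metric.ball (extChartAt (𝓡 N) x x) r ⊆ (extChartAt (𝓡 N) x).target ∧
      LipschitzOnWith C (extChartAt (𝓡 N) x).symm (Metric.ball (extChartAt (𝓡 N) x x) r) := by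
  have : IsContinuousRiemannianBundle (EuclideanSpace ℝ (Fin N))
    (fun x : M => TangentSpace (𝓡 N) x) := isContinuousRiemannianBundle_tangentSpace
  have : IsManifold (𝓡 N) 1 M := IsManifold.of_le (n := ∞) (by simp)
  obtain ⟨C, hC⟩ : ∃ C : ℝ≥0, ∀ᶠ y in 𝓝[range (𝓡 N)] (extChartAt (𝓡 N) x x),
      ∀ v : EuclideanSpace ℝ (Fin N), ‖(mfderivWithin 𝓘(ℝ, EuclideanSpace ℝ (Fin N)) (𝓡 N)
        (extChartAt (𝓡 N) x).symm (range (𝓡 N)) y v :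
          TangentSpace (𝓡 N) ((extChartAt (𝓡 N) x).symm y))‖ₑ ≤ C * ‖v‖ₑ := by
    rcases eventually_enorm_mfderivWithin_symm_extChartAt_lt (𝓡 N) x with ⟨C, -, hC⟩
    refine ⟨C, hC.mono fun y hy v => ?_⟩
    exact ((ContinuousLinearMap.le_opENorm _ v).trans (mul_le_mul_left hy.le _))
  obtain ⟨r, r_pos, hr⟩ : ∃ r > 0,
      Metric.ball (extChartAt (𝓡 N) x x) r ∩ range (𝓡 N) ⊆ (extChartAt (𝓡 N) x).target ∩
        {y | ∀ v : EuclideanSpace ℝ (Fin N),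
          ‖(mfderivWithin 𝓘(ℝ, EuclideanSpace ℝ (Fin N)) (𝓡 N)
            (extChartAt (𝓡 N) x).symm (range (𝓡 N)) y v :
              TangentSpace (𝓡 N) ((extChartAt (𝓡 N) x).symm y))‖ₑ ≤ C * ‖v‖ₑ} :=
    Metric.mem_nhdsWithin_iff.1 (inter_mem (extChartAt_target_mem_nhdsWithin x) hC)
  have hrange : range (𝓡 N) = univ := ModelWithCorners.range_eq_univ _
  have hr' := hr
  rw [hrange, inter_univ] at hr'
  refine ⟨C, r, r_pos, hr'.trans inter_subset_left, fun a ha b hb => ?_⟩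
  rw [IsRiemannianManifold.out (I := 𝓡 N)]
  -- By convexity the segment from $a$ to $b$ stays in the ball, where the derivative of the inverse
  -- chart is bounded by $C$. Its image is a path of length at most $C|a-b|$, which dominates the
  -- Riemannian distance of its ends.
  let η := ContinuousAffineMap.lineMap (R := ℝ) a b
  set γ := (extChartAt (𝓡 N) x).symm ∘ η
  have hη : Icc 0 1 ⊆ ⇑η ⁻¹' ((extChartAt (𝓡 N) x).target ∩
        {y | ∀ v : EuclideanSpace ℝ (Fin N),
          ‖(mfderivWithin 𝓘(ℝ, EuclideanSpace ℝ (Fin N)) (𝓡 N)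
            (extChartAt (𝓡 N) x).symm (range (𝓡 N)) y v :
              TangentSpace (𝓡 N) ((extChartAt (𝓡 N) x).symm y))‖ₑ ≤ C * ‖v‖ₑ}) := by
    simp only [← image_subset_iff, ContinuousAffineMap.coe_lineMap_eq,
     ← segment_eq_image_lineMap, η]
    apply Subset.trans _ hr
    exact ((convex_ball _ _).inter (𝓡 N).convex_range).segment_subset
      ⟨ha, by simp⟩ ⟨hb, by simp⟩
  simp only [preimage_inter, subset_inter_iff] at hη
  have η_smooth : ContMDiffOn 𝓘(ℝ, ℝ) 𝓘(ℝ, EuclideanSpace ℝ (Fin N)) 1 η (Icc 0 1) := by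
    apply ContMDiff.contMDiffOn
    rw [contMDiff_iff_contDiff]
    exact ContinuousAffineMap.contDiff _
  have : Manifold.riemannianEDist (𝓡 N) ((extChartAt (𝓡 N) x).symm a)
      ((extChartAt (𝓡 N) x).symm b) ≤ Manifold.pathELength (𝓡 N) γ 0 1 := by
    apply Manifold.riemannianEDist_le_pathELength _ _ _ zero_le_one
    · exact (contMDiffOn_extChartAt_symm x).comp η_smooth hη.1
    · simp [γ, η, ContinuousAffineMap.coe_lineMap_eq]
    · simp [γ, η, ContinuousAffineMap.coe_lineMap_eq]
  apply this.trans
  rw [← lintegral_fderiv_lineMap_eq_edist,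
    Manifold.pathELength_eq_lintegral_mfderivWithin_Icc,
    ← lintegral_const_mul' _ _ ENNReal.coe_ne_top]
  apply setLIntegral_mono' measurableSet_Icc (fun t ht ↦ ?_)
  have : mfderivWithin 𝓘(ℝ, ℝ) (𝓡 N) γ (Icc 0 1) t =
      (mfderivWithin 𝓘(ℝ, EuclideanSpace ℝ (Fin N)) (𝓡 N)
        (extChartAt (𝓡 N) x).symm (range (𝓡 N)) (η t)) ∘L (mfderivWithin 𝓘(ℝ, ℝ) 𝓘(ℝ, EuclideanSpace ℝ (Fin N)) η (Icc 0 1) t) := by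
    apply mfderivWithin_comp
    · exact mdifferentiableWithinAt_extChartAt_symm (hη.1 ht)
    · exact η_smooth.mdifferentiableOn one_ne_zero t ht
    · exact hη.1.trans (preimage_mono (extChartAt_target_subset_range x))
    · rw [uniqueMDiffWithinAt_iff_uniqueDiffWithinAt]
      exact uniqueDiffOn_Icc zero_lt_one t ht
  have : mfderivWithin 𝓘(ℝ, ℝ) (𝓡 N) γ (Icc 0 1) t 1 =
      (mfderivWithin 𝓘(ℝ, EuclideanSpace ℝ (Fin N)) (𝓡 N)
        (extChartAt (𝓡 N) x).symm (range (𝓡 N)) (η t)) (mfderivWithin 𝓘(ℝ, ℝ) 𝓘(ℝ, EuclideanSpace ℝ (Fin N)) η (Icc 0 1) t 1) :=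
    congr($this 1)
  rw [this]
  refine (hη.2 ht _).trans ?_
  gcongr
  · simp only [mfderivWithin_eq_fderivWithin]
    exact le_of_eq rfl

/-- Each point has a neighbourhood that is a Lipschitz image of a Euclidean ball, and Lipschitz maps
enlarge the $N$-dimensional Hausdorff measure by at most a constant factor. -/
theorem isLocallyFiniteMeasure_euclideanHausdorffMeasure [IsRiemannianManifold (𝓡 N) M]
    [MeasurableSpace M] [BorelSpace M] : IsLocallyFiniteMeasure (μHE[N] : Measure M) := by
  refine ⟨fun x => ?_⟩
  obtain ⟨C, r, hr, hsub, hlip⟩ := exists_lipschitzOnWith_extChartAt_symm (N := N) x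
  set B := Metric.ball (extChartAt (𝓡 N) x x) r with hB
  have hmem : (extChartAt (𝓡 N) x).symm '' B ∈ 𝓝 x := by
    have h1 : (extChartAt (𝓡 N) x).source ∩ extChartAt (𝓡 N) x ⁻¹' B ∈ 𝓝 x :=
      inter_mem (extChartAt_source_mem_nhds x)
        ((continuousAt_extChartAt x).preimage_mem_nhds (Metric.ball_mem_nhds _ hr))
    refine mem_of_superset h1 fun y hy => ⟨_, hy.2, (extChartAt (𝓡 N) x).left_inv hy.1⟩
  refine ⟨_, hmem, ?_⟩
  rw [Measure.euclideanHausdorffMeasure_def]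
  -- `μHE[N]` is a nonzero multiple of `μH[N]` and equals Lebesgue measure on Euclidean space, so
  -- finiteness transfers.
  have h2 : (μH[N] : Measure (EuclideanSpace ℝ (Fin N))) B < ⊤ := by
    have h3 : (μHE[N] : Measure (EuclideanSpace ℝ (Fin N))) B < ⊤ := by
      rw [EuclideanSpace.euclideanHausdorffMeasure_eq_volume]
      exact measure_ball_lt_top
    rw [Measure.euclideanHausdorffMeasure_def, Measure.smul_apply, ENNReal.smul_def,
      smul_eq_mul] at h3
    exact ENNReal.lt_top_of_mul_ne_top_right h3.ne (by
      simpa using Measure.addHaarScalarFactor_volume_hausdorffMeasure_ne_zero N)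
  rw [Measure.smul_apply, ENNReal.smul_def, smul_eq_mul]
  refine ENNReal.mul_lt_top ENNReal.coe_lt_top ?_
  refine (hlip.hausdorffMeasure_image_le N.cast_nonneg).trans_lt ?_
  exact ENNReal.mul_lt_top (ENNReal.rpow_lt_top_of_nonneg N.cast_nonneg ENNReal.coe_ne_top) h2

end LocallyFinite

/-! ### Measurable orthonormal frames -/

section TangentSpace

variable {N : ℕ} {M : Type*} [TopologicalSpace M] [ChartedSpace (EuclideanSpace ℝ (Fin N)) M]

theorem finrank_tangentSpace_euclidean (x : M) :
    Module.finrank ℝ (TangentSpace (𝓡 N) x) = Fintype.card (Fin N) := by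
  change Module.finrank ℝ (EuclideanSpace ℝ (Fin N)) = _
  simp

instance finiteDimensional_tangentSpace_euclidean (x : M) :
    FiniteDimensional ℝ (TangentSpace (𝓡 N) x) :=
  inferInstanceAs (FiniteDimensional ℝ (EuclideanSpace ℝ (Fin N)))

end TangentSpace

section Frame

variable {N : ℕ} {M : Type*} [TopologicalSpace M] [ChartedSpace (EuclideanSpace ℝ (Fin N)) M]
  [IsManifold (𝓡 N) ∞ M]

/-- The coordinate vector fields of the distinguished chart at `c`. -/
noncomputable def chartFrame (c : M) (i : Fin N) : VField N M := fun x =>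
  (trivializationAt (EuclideanSpace ℝ (Fin N)) (TangentSpace (𝓡 N) (M := M)) c).symm x
    (EuclideanSpace.basisFun (Fin N) ℝ i)

theorem eq_sum_chartFrame (X : VField N M) {c x : M}
    (hx : x ∈ (chartAt (EuclideanSpace ℝ (Fin N)) c).source) :
    X x = ∑ i, ((trivializationAt (EuclideanSpace ℝ (Fin N))
      (TangentSpace (𝓡 N)) c).continuousLinearMapAt ℝ x (X x)) i • chartFrame c i x := by
  let e := trivializationAt (EuclideanSpace ℝ (Fin N)) (TangentSpace (𝓡 N) (M := M)) c
  have hx' : x ∈ e.baseSet := hx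
  have h1 : e.symmL ℝ x (e.continuousLinearMapAt ℝ x (X x)) = X x :=
    e.symmL_continuousLinearMapAt hx' _
  conv_lhs => rw [← h1, ← (EuclideanSpace.basisFun (Fin N) ℝ).sum_repr
    (e.continuousLinearMapAt ℝ x (X x)), map_sum]
  refine Finset.sum_congr rfl fun i _ => ?_
  rw [map_smul, e.symmL_apply hx']
  simp [chartFrame, e]

theorem continuousLinearMapAt_chartFrame {c x : M}
    (hx : x ∈ (chartAt (EuclideanSpace ℝ (Fin N)) c).source) (i : Fin N) :
    (trivializationAt (EuclideanSpace ℝ (Fin N))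
      (TangentSpace (𝓡 N)) c).continuousLinearMapAt ℝ x (chartFrame c i x)
      = EuclideanSpace.basisFun (Fin N) ℝ i := by
  let e := trivializationAt (EuclideanSpace ℝ (Fin N)) (TangentSpace (𝓡 N) (M := M)) c
  have hx' : x ∈ e.baseSet := hx
  have := e.continuousLinearMapAt_symmL (R := ℝ) hx' (EuclideanSpace.basisFun (Fin N) ℝ i)
  rwa [e.symmL_apply hx'] at this

theorem linearIndependent_chartFrame {c x : M}
    (hx : x ∈ (chartAt (EuclideanSpace ℝ (Fin N)) c).source) :
    LinearIndependent ℝ fun i => chartFrame (N := N) c i x := by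
  let e := trivializationAt (EuclideanSpace ℝ (Fin N)) (TangentSpace (𝓡 N) (M := M)) c
  refine LinearIndependent.of_comp (e.continuousLinearMapAt ℝ x).toLinearMap ?_
  have : (e.continuousLinearMapAt ℝ x).toLinearMap ∘ (fun i => chartFrame (N := N) c i x)
      = EuclideanSpace.basisFun (Fin N) ℝ := by
    funext i
    exact continuousLinearMapAt_chartFrame hx i
  rw [this]
  exact (EuclideanSpace.basisFun (Fin N) ℝ).toBasis.linearIndependent

theorem continuousOn_chartFrame (c : M) (i : Fin N) :
    ContinuousOn (fun x => TotalSpace.mk' (EuclideanSpace ℝ (Fin N)) x (chartFrame c i x))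
      (chartAt (EuclideanSpace ℝ (Fin N)) c).source :=
  (trivializationAt (EuclideanSpace ℝ (Fin N)) (TangentSpace (𝓡 N) (M := M))
    c).continuousOn_symm.comp
      (f := fun x : M => (x, EuclideanSpace.basisFun (Fin N) ℝ i)) (by fun_prop)
        (fun x hx => ⟨hx, mem_univ _⟩)

section OrthonormalFrame

variable [RiemannianBundle (fun x : M => TangentSpace (𝓡 N) x)]

/-- The orthonormal frame that the Gram-Schmidt process yields from the coordinate vector fields of
the distinguished chart at `c`. -/
noncomputable def chartOrthonormalFrame (c x : M) :
    OrthonormalBasis (Fin N) ℝ (TangentSpace (𝓡 N) x) :=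
  InnerProductSpace.gramSchmidtOrthonormalBasis (finrank_tangentSpace_euclidean x)
    fun i => chartFrame (N := N) c i x

theorem chartOrthonormalFrame_apply {c x : M}
    (hx : x ∈ (chartAt (EuclideanSpace ℝ (Fin N)) c).source) (i : Fin N) :
    chartOrthonormalFrame c x i
      = InnerProductSpace.gramSchmidtNormed ℝ (fun j => chartFrame (N := N) c j x) i := by
  have h1 : ‖InnerProductSpace.gramSchmidtNormed ℝ (fun j => chartFrame (N := N) c j x) i‖ = 1 :=
    InnerProductSpace.gramSchmidtNormed_unit_length i (linearIndependent_chartFrame hx)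
  have h0 : InnerProductSpace.gramSchmidtNormed ℝ (fun j => chartFrame (N := N) c j x) i ≠ 0 :=
    norm_ne_zero_iff.1 (by rw [h1]; exact one_ne_zero)
  exact InnerProductSpace.gramSchmidtOrthonormalBasis_apply _ h0

end OrthonormalFrame

variable [MeasurableSpace M]

/-- The vector field `X` is measurable on `A` in the coordinates of the distinguished chart
at `c`. -/
def VField.MeasOn (X : VField N M) (μ : Measure M) (c : M) (A : Set M) : Prop :=
  AEStronglyMeasurable (fun x => (trivializationAt (EuclideanSpace ℝ (Fin N))
    (TangentSpace (𝓡 N)) c).continuousLinearMapAt ℝ x (X x)) (μ.restrict A)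

variable {μ : Measure M} {c : M} {A : Set M}

theorem VField.MeasOn.apply {X : VField N M} (hX : X.MeasOn μ c A) (i : Fin N) :
    AEStronglyMeasurable (fun x => ((trivializationAt (EuclideanSpace ℝ (Fin N))
      (TangentSpace (𝓡 N)) c).continuousLinearMapAt ℝ x (X x)) i) (μ.restrict A) :=
  (EuclideanSpace.proj (𝕜 := ℝ) i).continuous.comp_aestronglyMeasurable hX

theorem VField.MeasOn.smul {X : VField N M} (hX : X.MeasOn μ c A) {a : M → ℝ}
    (ha : AEStronglyMeasurable a (μ.restrict A)) :
    VField.MeasOn (N := N) (fun x => a x • X x) μ c A := by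
  refine (ha.smul hX).congr (Eventually.of_forall fun x => ?_)
  simp

theorem VField.MeasOn.sub {X Y : VField N M} (hX : X.MeasOn μ c A) (hY : Y.MeasOn μ c A) :
    VField.MeasOn (N := N) (fun x => X x - Y x) μ c A := by
  refine (AEStronglyMeasurable.sub hX hY).congr (Eventually.of_forall fun x => ?_)
  simp

theorem VField.MeasOn.sum {ι : Type*} (s : Finset ι) {X : ι → VField N M}
    (hX : ∀ i ∈ s, (X i).MeasOn μ c A) :
    VField.MeasOn (N := N) (fun x => ∑ i ∈ s, X i x) μ c A := by
  refine (Finset.aestronglyMeasurable_fun_sum s hX).congr (Eventually.of_forall fun x => ?_)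
  simp

theorem VField.MeasOn.congr {X Y : VField N M} (hX : X.MeasOn μ c A) (hA : MeasurableSet A)
    (h : ∀ x ∈ A, X x = Y x) : Y.MeasOn μ c A := by
  refine AEStronglyMeasurable.congr hX ?_
  filter_upwards [ae_restrict_mem hA] with x hx
  rw [h x hx]

theorem VField.MeasOn.mono {B : Set M} {X : VField N M} (hX : X.MeasOn μ c A) (h : B ⊆ A) :
    X.MeasOn μ c B :=
  AEStronglyMeasurable.mono_set h hX

variable [BorelSpace M]

theorem measOn_chartFrame {c' : M} (hA : MeasurableSet A)
    (hc : A ⊆ (chartAt (EuclideanSpace ℝ (Fin N)) c).source)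
    (hc' : A ⊆ (chartAt (EuclideanSpace ℝ (Fin N)) c').source) (i : Fin N) :
    (chartFrame (N := N) c i).MeasOn μ c' A := by
  let e := trivializationAt (EuclideanSpace ℝ (Fin N)) (TangentSpace (𝓡 N) (M := M)) c'
  have h1 : ContinuousOn (fun x => (e (TotalSpace.mk' (EuclideanSpace ℝ (Fin N)) x
      (chartFrame c i x))).2) A :=
    continuous_snd.comp_continuousOn (e.continuousOn.comp ((continuousOn_chartFrame c i).mono hc)
      fun x hx => e.mem_source.2 (hc' hx))
  refine (h1.aestronglyMeasurable hA).congr ?_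
  filter_upwards [ae_restrict_mem hA] with x hx
  exact (e.continuousLinearMapAt_apply_of_mem (R := ℝ) (hc' hx) _).symm

/-- Measurability is independent of the chart: $X$ combines the old coordinate fields, which are
continuous in the new chart, with measurable coefficients. -/
theorem VField.MeasOn.change {X : VField N M} (hX : X.MeasOn μ c A) {c' : M}
    (hA : MeasurableSet A) (hc : A ⊆ (chartAt (EuclideanSpace ℝ (Fin N)) c).source)
    (hc' : A ⊆ (chartAt (EuclideanSpace ℝ (Fin N)) c').source) : X.MeasOn μ c' A :=
  (VField.MeasOn.sum Finset.univ fun i _ =>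
    (measOn_chartFrame hA hc hc' i).smul (hX.apply i)).congr hA fun _ hx =>
      (eq_sum_chartFrame X (hc hx)).symm

variable [RiemannianBundle (fun x : M => TangentSpace (𝓡 N) x)]
  [IsContMDiffRiemannianBundle (𝓡 N) ∞ (EuclideanSpace ℝ (Fin N))
    (fun x : M => TangentSpace (𝓡 N) x)]

theorem VField.MeasOn.aestronglyMeasurable_inner {X Y : VField N M} (hX : X.MeasOn μ c A) (hY : Y.MeasOn μ c A)
    (hA : MeasurableSet A) (hc : A ⊆ (chartAt (EuclideanSpace ℝ (Fin N)) c).source) :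
    AEStronglyMeasurable (fun x => inner ℝ (X x) (Y x)) (μ.restrict A) := by
  have : IsContinuousRiemannianBundle (EuclideanSpace ℝ (Fin N))
    (fun x : M => TangentSpace (𝓡 N) x) := isContinuousRiemannianBundle_tangentSpace
  have hss : ∀ i j, AEStronglyMeasurable
      (fun x => inner ℝ (chartFrame (N := N) c i x) (chartFrame c j x)) (μ.restrict A) := fun i j =>
    (((continuousOn_chartFrame c i).mono hc).inner_bundle
      ((continuousOn_chartFrame c j).mono hc)).aestronglyMeasurable hA
  have hsum := Finset.aestronglyMeasurable_fun_sum Finset.univ fun i (_ : i ∈ Finset.univ) =>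
    Finset.aestronglyMeasurable_fun_sum Finset.univ fun j (_ : j ∈ Finset.univ) =>
      ((hX.apply i).mul (hY.apply j)).mul (hss i j)
  refine hsum.congr ?_
  filter_upwards [ae_restrict_mem hA] with x hx
  conv_rhs => rw [eq_sum_chartFrame X (hc hx), eq_sum_chartFrame Y (hc hx)]
  simp only [sum_inner, inner_sum, real_inner_smul_left, real_inner_smul_right]
  conv_rhs => rw [Finset.sum_comm]
  refine Finset.sum_congr rfl fun i _ => Finset.sum_congr rfl fun j _ => ?_
  simp only [Pi.mul_apply]
  ring

/-- Gram–Schmidt forms only inner products, quotients and linear combinations of earlier vectors,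
all of which preserve measurability. -/
theorem measOn_gramSchmidt_chartFrame (hA : MeasurableSet A)
    (hc : A ⊆ (chartAt (EuclideanSpace ℝ (Fin N)) c).source) (i : Fin N) :
    VField.MeasOn (N := N) (fun x => InnerProductSpace.gramSchmidt ℝ
      (fun j => chartFrame (N := N) c j x) i) μ c A := by
  induction i using WellFoundedLT.induction with
  | ind i ih =>
  have hs := fun i => measOn_chartFrame (μ := μ) hA hc hc i
  have hsum : VField.MeasOn (N := N) (fun x => ∑ j ∈ Finset.Iio i,
      (inner ℝ (InnerProductSpace.gramSchmidt ℝ (fun k => chartFrame (N := N) c k x) j)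
        (chartFrame (N := N) c i x)
        / ‖InnerProductSpace.gramSchmidt ℝ (fun k => chartFrame (N := N) c k x) j‖ ^ 2) •
        InnerProductSpace.gramSchmidt ℝ (fun k => chartFrame (N := N) c k x) j) μ c A := by
    refine VField.MeasOn.sum _ fun j hj => ?_
    have hj' := ih j (Finset.mem_Iio.1 hj)
    refine hj'.smul ?_
    have h1 := (hj'.aestronglyMeasurable_inner (hs i) hA hc).aemeasurable
    have h2 := (hj'.aestronglyMeasurable_inner hj' hA hc).aemeasurable
    simp only [real_inner_self_eq_norm_sq] at h2
    exact (h1.div h2).aestronglyMeasurable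
  refine ((hs i).sub hsum).congr hA fun x _ => ?_
  rw [InnerProductSpace.gramSchmidt_def]
  congr 1
  refine Finset.sum_congr rfl fun j _ => ?_
  rw [Submodule.starProjection_singleton]
  rfl

theorem measOn_gramSchmidtNormed_chartFrame (hA : MeasurableSet A)
    (hc : A ⊆ (chartAt (EuclideanSpace ℝ (Fin N)) c).source) (i : Fin N) :
    VField.MeasOn (N := N) (fun x => InnerProductSpace.gramSchmidtNormed ℝ
      (fun j => chartFrame (N := N) c j x) i) μ c A := by
  have h := measOn_gramSchmidt_chartFrame (μ := μ) hA hc i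
  have h1 := (h.aestronglyMeasurable_inner h hA hc).aemeasurable
  simp only [real_inner_self_eq_norm_sq] at h1
  refine (h.smul (a := fun x => (√(‖InnerProductSpace.gramSchmidt ℝ
    (fun j => chartFrame (N := N) c j x) i‖ ^ 2))⁻¹) h1.sqrt.inv.aestronglyMeasurable).congr hA
      fun x _ => ?_
  rw [Real.sqrt_sq (norm_nonneg _)]
  rfl

theorem measOn_chartOrthonormalFrame (hA : MeasurableSet A)
    (hc : A ⊆ (chartAt (EuclideanSpace ℝ (Fin N)) c).source) (i : Fin N) :
    VField.MeasOn (N := N) (fun x => chartOrthonormalFrame c x i) μ c A :=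
  (measOn_gramSchmidtNormed_chartFrame (μ := μ) hA hc i).congr hA fun _ hx =>
    (chartOrthonormalFrame_apply (hc hx) i).symm

/-- The isometries `O x` of the tangent spaces with the Euclidean space form a measurable
orthonormal frame: measurable vector fields correspond to measurable functions with values in the
Euclidean space. -/
structure IsMeasurableFrame (μ : Measure M)
    (O : ∀ x : M, TangentSpace (𝓡 N) x ≃ₗᵢ[ℝ] EuclideanSpace ℝ (Fin N)) : Prop where
  aestronglyMeasurable : ∀ {X : VField N M}, X.AEMeas μ →
    AEStronglyMeasurable (fun x => O x (X x)) μ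
  aeMeas : ∀ {F : M → EuclideanSpace ℝ (Fin N)}, AEStronglyMeasurable F μ →
    VField.AEMeas (N := N) (fun x => (O x).symm (F x)) μ

variable (N M) in
-- Countably many chart domains cover $M$. Made disjoint, they give measurable pieces, and on each
-- piece the Gram–Schmidt frame of its own chart is used; `κ x` is the index of the piece containing
-- `x`.
theorem exists_isMeasurableFrame [SecondCountableTopology M] (μ : Measure M) :
    ∃ O : ∀ x : M, TangentSpace (𝓡 N) x ≃ₗᵢ[ℝ] EuclideanSpace ℝ (Fin N),
      IsMeasurableFrame μ O := by
  rcases isEmpty_or_nonempty M with hM | hM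
  · refine ⟨fun x => isEmptyElim x, fun _ => ?_, fun _ c => isEmptyElim c⟩
    rw [Measure.eq_zero_of_isEmpty μ]
    exact aestronglyMeasurable_zero_measure _
  obtain ⟨S, hS, hcov⟩ := TopologicalSpace.countable_cover_nhds
    (fun x : M => (chartAt (EuclideanSpace ℝ (Fin N)) x).open_source.mem_nhds
      (mem_chart_source (EuclideanSpace ℝ (Fin N)) x))
  have hSne : S.Nonempty := by
    rw [nonempty_iff_ne_empty]
    rintro rfl
    simp at hcov
    exact hM.elim fun x => by simpa [← hcov] using mem_univ x
  obtain ⟨u, hu⟩ := hS.exists_eq_range hSne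
  let U : ℕ → Set M := fun k => (chartAt (EuclideanSpace ℝ (Fin N)) (u k)).source
  have hU : ∀ k, MeasurableSet (U k) := fun k =>
    (chartAt (EuclideanSpace ℝ (Fin N)) (u k)).open_source.measurableSet
  have hUcov : ⋃ k, disjointed U k = univ := by
    rw [iUnion_disjointed, ← hcov, hu, biUnion_range]
  have hDm : ∀ k, MeasurableSet (disjointed U k) := fun k => MeasurableSet.disjointed hU k
  have hex : ∀ x, ∃ k, x ∈ disjointed U k := fun x => by
    simpa [← hUcov] using mem_univ x
  choose κ hκ using hex
  have hκ' : ∀ k, ∀ x ∈ disjointed U k, κ x = k := fun k x hx => by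
    by_contra hne
    exact (disjoint_disjointed U hne).le_bot ⟨hκ x, hx⟩
  have hsub : ∀ k, disjointed U k ⊆ U k := fun k => disjointed_subset U k
  refine ⟨fun x => (chartOrthonormalFrame (u (κ x)) x).repr, fun {X} hX => ?_,
    fun {F} hF c => ?_⟩
  · rw [← Measure.restrict_univ (μ := μ), ← hUcov, aestronglyMeasurable_iUnion_iff]
    intro k
    have hXk : X.MeasOn μ (u k) (disjointed U k) := VField.MeasOn.mono (hX (u k)) (hsub k)
    have h1 : ∀ i, AEMeasurable
        (fun x => inner ℝ (chartOrthonormalFrame (N := N) (u k) x i) (X x))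
        (μ.restrict (disjointed U k)) := fun i =>
      ((measOn_chartOrthonormalFrame (hDm k) (hsub k) i).aestronglyMeasurable_inner hXk (hDm k)
        (hsub k)).aemeasurable
    have h2 : AEMeasurable (fun x => WithLp.toLp 2 fun i =>
        inner ℝ (chartOrthonormalFrame (N := N) (u k) x i) (X x)) (μ.restrict (disjointed U k)) :=
      (WithLp.measurable_toLp 2 _).comp_aemeasurable (aemeasurable_pi_lambda _ h1)
    refine h2.aestronglyMeasurable.congr ?_
    filter_upwards [ae_restrict_mem (hDm k)] with x hx
    ext i
    rw [hκ' k x hx, OrthonormalBasis.repr_apply_apply]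
  · have : (⋃ k, disjointed U k ∩ (chartAt (EuclideanSpace ℝ (Fin N)) c).source)
        = (chartAt (EuclideanSpace ℝ (Fin N)) c).source := by
      rw [← iUnion_inter, hUcov, univ_inter]
    rw [← this, aestronglyMeasurable_iUnion_iff]
    intro k
    set A := disjointed U k ∩ (chartAt (EuclideanSpace ℝ (Fin N)) c).source with hAdef
    have hA : MeasurableSet A :=
      (hDm k).inter (chartAt (EuclideanSpace ℝ (Fin N)) c).open_source.measurableSet
    have hA1 : A ⊆ (chartAt (EuclideanSpace ℝ (Fin N)) (u k)).source :=
      inter_subset_left.trans (hsub k)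
    have hA2 : A ⊆ (chartAt (EuclideanSpace ℝ (Fin N)) c).source := inter_subset_right
    have h1 : ∀ i, AEStronglyMeasurable (fun x => F x i) (μ.restrict A) := fun i =>
      ((EuclideanSpace.proj (𝕜 := ℝ) i).continuous.comp_aestronglyMeasurable hF).restrict
    refine ((VField.MeasOn.sum Finset.univ fun i _ =>
      (measOn_chartOrthonormalFrame hA hA1 i).smul (h1 i)).change hA hA1 hA2).congr hA
        fun x hx => ?_
    simp only [hκ' k x hx.1]
    exact OrthonormalBasis.sum_repr_symm _ _

end Frame

/-! ### Gradients of test functions -/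

section TestFun

variable {N : ℕ} {M : Type*} [TopologicalSpace M] [ChartedSpace (EuclideanSpace ℝ (Fin N)) M]

theorem IsTestFun.mdifferentiableAt {φ : M → ℝ} (hφ : IsTestFun N φ) (x : M) :
    MDifferentiableAt (𝓡 N) 𝓘(ℝ, ℝ) φ x :=
  hφ.1.mdifferentiable (by simp) x

theorem isTestFun_zero : IsTestFun N (0 : M → ℝ) :=
  ⟨contMDiff_const, HasCompactSupport.zero⟩

theorem IsTestFun.add {φ ψ : M → ℝ} (hφ : IsTestFun N φ) (hψ : IsTestFun N ψ) :
    IsTestFun N (φ + ψ) :=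
  ⟨hφ.1.add hψ.1, hφ.2.add hψ.2⟩

theorem IsTestFun.smul (c : ℝ) {φ : M → ℝ} (hφ : IsTestFun N φ) : IsTestFun N (c • φ) :=
  ⟨(contMDiff_const (I' := 𝓘(ℝ, ℝ)) (c := c)).smul hφ.1, hφ.2.smul_left (f := fun _ => c)⟩

/-- The derivative of `φ` at `x` in the direction `v`. -/
noncomputable def dirDeriv (φ : M → ℝ) (x : M) (v : TangentSpace (𝓡 N) x) : ℝ :=
  mfderiv (𝓡 N) 𝓘(ℝ, ℝ) φ x v

theorem dirDeriv_add {φ ψ : M → ℝ} (hφ : IsTestFun N φ) (hψ : IsTestFun N ψ) {x : M}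
    (v : TangentSpace (𝓡 N) x) :
    dirDeriv (φ + ψ) x v = dirDeriv φ x v + dirDeriv ψ x v :=
  DFunLike.congr_fun (mfderiv_add (hφ.mdifferentiableAt x) (hψ.mdifferentiableAt x)) v

theorem dirDeriv_smul (c : ℝ) {φ : M → ℝ} (hφ : IsTestFun N φ) {x : M}
    (v : TangentSpace (𝓡 N) x) : dirDeriv (c • φ) x v = c * dirDeriv φ x v :=
  DFunLike.congr_fun (const_smul_mfderiv (hφ.mdifferentiableAt x) c) v

variable [IsManifold (𝓡 N) ∞ M]

theorem continuousOn_dirDeriv_chartFrame {φ : M → ℝ} (hφ : IsTestFun N φ) (c : M) (i : Fin N) :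
    ContinuousOn (fun x => dirDeriv φ x (chartFrame c i x))
      (chartAt (EuclideanSpace ℝ (Fin N)) c).source := by
  have h1 := (hφ.1.continuous_tangentMap (by simp)).comp_continuousOn (continuousOn_chartFrame c i)
  have h2 : Continuous (fun z : TangentBundle 𝓘(ℝ, ℝ) ℝ => (z.2 : ℝ)) := by
    have := (tangentBundleModelSpaceHomeomorph 𝓘(ℝ, ℝ)).continuous
    rw [tangentBundleModelSpaceHomeomorph_coe] at this
    exact continuous_snd.comp this
  exact h2.comp_continuousOn h1

theorem dirDeriv_eq_sum_chartFrame (φ : M → ℝ) {c x : M}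
    (hx : x ∈ (chartAt (EuclideanSpace ℝ (Fin N)) c).source) (v : TangentSpace (𝓡 N) x) :
    dirDeriv φ x v = ∑ i, ((trivializationAt (EuclideanSpace ℝ (Fin N))
      (TangentSpace (𝓡 N)) c).continuousLinearMapAt ℝ x v) i *
        dirDeriv φ x (chartFrame c i x) := by
  classical
  -- The expansion is stated for vector fields, so $v$ is extended by zero to the other points.
  have h := eq_sum_chartFrame (fun y => if h : x = y then h ▸ v else 0 : VField N M) hx
  simp only [dite_true] at h
  conv_lhs => rw [h]
  rw [dirDeriv, map_sum]
  refine Finset.sum_congr rfl fun i _ => ?_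
  rw [map_smul]
  rfl

end TestFun

section Grad

variable {N : ℕ} {M : Type*} [TopologicalSpace M] [ChartedSpace (EuclideanSpace ℝ (Fin N)) M]
  [RiemannianBundle (fun x : M => TangentSpace (𝓡 N) x)]

theorem VField.inner_grad_left (φ : M → ℝ) {x : M} (v : TangentSpace (𝓡 N) x) :
    inner ℝ (VField.grad (N := N) φ x) v = dirDeriv φ x v := by
  have : CompleteSpace (TangentSpace (𝓡 N) x) := FiniteDimensional.complete ℝ _
  exact InnerProductSpace.toDual_symm_apply

theorem VField.grad_eq_of_inner {φ : M → ℝ} {x : M} {w : TangentSpace (𝓡 N) x}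
    (h : ∀ v : TangentSpace (𝓡 N) x, inner ℝ w v = dirDeriv φ x v) :
    VField.grad (N := N) φ x = w :=
  ext_inner_right ℝ fun v => by rw [VField.inner_grad_left, h]

theorem VField.grad_add {φ ψ : M → ℝ} (hφ : IsTestFun N φ) (hψ : IsTestFun N ψ) (x : M) :
    VField.grad (N := N) (φ + ψ) x = VField.grad φ x + VField.grad ψ x := by
  refine VField.grad_eq_of_inner fun v => ?_
  rw [inner_add_left, VField.inner_grad_left, VField.inner_grad_left,
    dirDeriv_add hφ hψ]

theorem VField.grad_smul (c : ℝ) {φ : M → ℝ} (hφ : IsTestFun N φ) (x : M) :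
    VField.grad (N := N) (c • φ) x = c • VField.grad φ x := by
  refine VField.grad_eq_of_inner fun v => ?_
  rw [real_inner_smul_left, VField.inner_grad_left,
    dirDeriv_smul c hφ]

theorem VField.grad_eq_zero {φ : M → ℝ} {x : M} (hx : x ∉ tsupport φ) :
    VField.grad (N := N) φ x = 0 := by
  refine VField.grad_eq_of_inner fun v => ?_
  have h : φ =ᶠ[𝓝 x] fun _ => 0 := notMem_tsupport_iff_eventuallyEq.1 hx
  rw [dirDeriv, h.mfderiv_eq, mfderiv_const, inner_zero_left]
  rfl

variable [IsManifold (𝓡 N) ∞ M]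

variable [IsContMDiffRiemannianBundle (𝓡 N) ∞ (EuclideanSpace ℝ (Fin N))
    (fun x : M => TangentSpace (𝓡 N) x)]

/-- With $w=\nabla\varphi(x)$, $|w|^2=d\varphi(w)=\sum_i w^i\partial_i\varphi$. Near $c$ the
components satisfy $|w^i|\le B|w|$ and the partial derivatives are bounded, so one factor $|w|$
cancels. -/
theorem eventually_norm_grad_le {φ : M → ℝ} (hφ : IsTestFun N φ) (c : M) :
    ∃ C : ℝ, ∀ᶠ x in 𝓝 c, ‖VField.grad (N := N) φ x‖ ≤ C := by
  have : IsContinuousRiemannianBundle (EuclideanSpace ℝ (Fin N))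
    (fun x : M => TangentSpace (𝓡 N) x) := isContinuousRiemannianBundle_tangentSpace
  let e := trivializationAt (EuclideanSpace ℝ (Fin N)) (TangentSpace (𝓡 N) (M := M)) c
  obtain ⟨B, hB, hBe⟩ : ∃ B : ℝ, 0 < B ∧ ∀ᶠ x in 𝓝 c, ∀ v : TangentSpace (𝓡 N) x,
      ‖e.continuousLinearMapAt ℝ x v‖ ≤ B * ‖v‖ := by
    obtain ⟨B, hB, h⟩ := eventually_norm_trivializationAt_lt (EuclideanSpace ℝ (Fin N))
      (fun x : M => TangentSpace (𝓡 N) x) c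
    exact ⟨B, hB, h.mono fun x hx v => ContinuousLinearMap.le_of_opNorm_le _ hx.le v⟩
  have hsrc : (chartAt (EuclideanSpace ℝ (Fin N)) c).source ∈ 𝓝 c := chart_source_mem_nhds _ c
  let d : Fin N → M → ℝ := fun i x => dirDeriv φ x (chartFrame c i x)
  have hd : ∀ i, ∀ᶠ x in 𝓝 c, |d i x| < |d i c| + 1 := fun i => by
    have hcont : ContinuousAt (d i) c := (continuousOn_dirDeriv_chartFrame hφ c i).continuousAt hsrc
    exact hcont.abs.eventually_lt_const (lt_add_one _)
  refine ⟨∑ i, B * (|d i c| + 1), ?_⟩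
  filter_upwards [hBe, hsrc, eventually_all.2 hd] with x hx hxs hxd
  set w := VField.grad (N := N) φ x with hw
  rcases (norm_nonneg w).eq_or_lt with h0 | h0
  · rw [← h0]; positivity
  have h1 : ‖w‖ * ‖w‖ ≤ ‖w‖ * ∑ i, B * (|d i c| + 1) := by
    calc ‖w‖ * ‖w‖ = inner ℝ w w := (real_inner_self_eq_norm_mul_norm w).symm
      _ = ∑ i, (e.continuousLinearMapAt ℝ x w) i * d i x := by
          rw [VField.inner_grad_left, dirDeriv_eq_sum_chartFrame φ hxs]
      _ ≤ ∑ i, ‖w‖ * (B * (|d i c| + 1)) := by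
          refine Finset.sum_le_sum fun i _ => ?_
          calc _ ≤ |(e.continuousLinearMapAt ℝ x w) i| * |d i x| := by
                rw [← abs_mul]; exact le_abs_self _
            _ ≤ (B * ‖w‖) * (|d i c| + 1) := by
                gcongr
                · exact (PiLp.norm_apply_le _ i).trans (hx w)
                · exact (hxd i).le
            _ = _ := by ring
      _ = _ := by rw [Finset.mul_sum]
  exact le_of_mul_le_mul_left h1 h0

theorem IsTestFun.exists_norm_grad_le {φ : M → ℝ} (hφ : IsTestFun N φ) :
    ∃ C : ℝ, ∀ x, ‖VField.grad (N := N) φ x‖ ≤ C := by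
  have hK : ∃ C : ℝ, ∀ x ∈ tsupport φ, ‖VField.grad (N := N) φ x‖ ≤ C := by
    refine hφ.2.isCompact.induction_on (p := fun s => ∃ C : ℝ, ∀ x ∈ s,
      ‖VField.grad (N := N) φ x‖ ≤ C) ⟨0, by simp⟩ ?_ ?_ ?_
    · rintro s t hst ⟨C, hC⟩
      exact ⟨C, fun x hx => hC x (hst hx)⟩
    · rintro s t ⟨C, hC⟩ ⟨D, hD⟩
      exact ⟨max C D, fun x hx => hx.elim (fun h => (hC x h).trans (le_max_left _ _))
        fun h => (hD x h).trans (le_max_right _ _)⟩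
    · intro x _
      obtain ⟨C, hC⟩ := eventually_norm_grad_le hφ x
      exact ⟨_, mem_nhdsWithin_of_mem_nhds hC, C, fun _ hy => hy⟩
  obtain ⟨C, hC⟩ := hK
  refine ⟨max C 0, fun x => ?_⟩
  by_cases hx : x ∈ tsupport φ
  · exact (hC x hx).trans (le_max_left _ _)
  · rw [VField.grad_eq_zero hx, norm_zero]; exact le_max_right _ _

variable [MeasurableSpace M] [BorelSpace M] {μ : Measure M}

/-- In an orthonormal frame $e_i$ the gradient is $\sum_i d\varphi(e_i)\,e_i$, with measurable
coefficients. -/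
theorem IsTestFun.grad_aeMeas {φ : M → ℝ} (hφ : IsTestFun N φ) :
    VField.AEMeas (N := N) (VField.grad φ) μ := by
  intro c
  set A := (chartAt (EuclideanSpace ℝ (Fin N)) c).source with hAdef
  have hA : MeasurableSet A := (chartAt (EuclideanSpace ℝ (Fin N)) c).open_source.measurableSet
  have hg := fun i => measOn_chartOrthonormalFrame (μ := μ) hA Subset.rfl i
  have hd := fun i => (continuousOn_dirDeriv_chartFrame hφ c i).aestronglyMeasurable (μ := μ) hA
  refine (VField.MeasOn.sum Finset.univ fun i _ => (hg i).smul
    (Finset.aestronglyMeasurable_fun_sum Finset.univ fun j _ =>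
      ((hg i).apply j).mul (hd j))).congr hA fun x hx => ?_
  conv_rhs => rw [← (chartOrthonormalFrame c x).sum_repr' (VField.grad φ x)]
  refine Finset.sum_congr rfl fun i _ => ?_
  rw [real_inner_comm, VField.inner_grad_left, dirDeriv_eq_sum_chartFrame φ hx]
  rfl

variable [SecondCountableTopology M]

theorem IsTestFun.grad_memLp [T2Space M] [IsFiniteMeasureOnCompacts μ] {φ : M → ℝ}
    (hφ : IsTestFun N φ) (p : ℝ≥0∞) : VField.MemLp (N := N) (VField.grad φ) p μ := by
  obtain ⟨C, hC⟩ := hφ.exists_norm_grad_le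
  have hmeas : VField.AEMeas (N := N) (VField.grad φ) μ := hφ.grad_aeMeas
  have h1 : MemLp ((tsupport φ).indicator fun _ => C) p μ :=
    memLp_indicator_const p (isClosed_tsupport φ).measurableSet C
      (Or.inr hφ.2.isCompact.measure_lt_top.ne)
  refine ⟨hmeas, (h1.of_le hmeas.norm (Eventually.of_forall fun x => ?_)).2⟩
  by_cases hx : x ∈ tsupport φ
  · rw [indicator_of_mem hx, norm_norm]
    exact (hC x).trans (le_abs_self C)
  · simp [VField.grad_eq_zero hx]

end Grad

/-! ### The resolvents of the Laplace–Beltrami operator -/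

section FrameLp

variable {N : ℕ} {M : Type*} [TopologicalSpace M]
  [ChartedSpace (EuclideanSpace ℝ (Fin N)) M] [IsManifold (𝓡 N) ∞ M]
  [RiemannianBundle (fun x : M => TangentSpace (𝓡 N) x)] [MeasurableSpace M] {μ : Measure M}
  {O : ∀ x : M, TangentSpace (𝓡 N) x ≃ₗᵢ[ℝ] EuclideanSpace ℝ (Fin N)}

theorem IsMeasurableFrame.memLp_comp (hO : IsMeasurableFrame μ O) {X : VField N M} {p : ℝ≥0∞}
    (hX : X.MemLp p μ) : MemLp (fun x => O x (X x)) p μ := by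
  refine ⟨hO.aestronglyMeasurable hX.1, ?_⟩
  rw [← eLpNorm_norm]
  simpa using hX.2

theorem IsMeasurableFrame.memLp_symm (hO : IsMeasurableFrame μ O)
    {F : M → EuclideanSpace ℝ (Fin N)} {p : ℝ≥0∞} (hF : MemLp F p μ) :
    VField.MemLp (N := N) (fun x => (O x).symm (F x)) p μ := by
  refine ⟨hO.aeMeas hF.1, ?_⟩
  simp only [LinearIsometryEquiv.norm_map, eLpNorm_norm]
  exact hF.2

end FrameLp

section Resolvent

variable {N : ℕ} {M : Type*} [TopologicalSpace M] [T2Space M] [SecondCountableTopology M]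
  [ChartedSpace (EuclideanSpace ℝ (Fin N)) M] [IsManifold (𝓡 N) ∞ M]
  [RiemannianBundle (fun x : M => TangentSpace (𝓡 N) x)]
  [IsContMDiffRiemannianBundle (𝓡 N) ∞ (EuclideanSpace ℝ (Fin N))
    (fun x : M => TangentSpace (𝓡 N) x)]
  [MeasurableSpace M] [BorelSpace M] {μ : Measure M}
  {O : ∀ x : M, TangentSpace (𝓡 N) x ≃ₗᵢ[ℝ] EuclideanSpace ℝ (Fin N)}

/-- The Hilbert space of pairs of a square integrable function and a square integrable vector
field, in an orthonormal frame. -/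
abbrev PairSpace (N : ℕ) {M : Type*} [MeasurableSpace M] (μ : Measure M) : Type _ :=
  WithLp 2 (Lp ℝ 2 μ × Lp (EuclideanSpace ℝ (Fin N)) 2 μ)

/-- The pairs `(φ, s ∇φ)` for test functions `φ`. -/
noncomputable def gradGraph (μ : Measure M)
    (O : ∀ x : M, TangentSpace (𝓡 N) x ≃ₗᵢ[ℝ] EuclideanSpace ℝ (Fin N)) (s : ℝ) :
    Submodule ℝ (PairSpace N μ) where
  carrier := {z | ∃ φ : M → ℝ, IsTestFun N φ ∧ z.fst =ᵐ[μ] φ ∧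
    z.snd =ᵐ[μ] fun x => s • O x (VField.grad φ x)}
  zero_mem' := by
    refine ⟨0, isTestFun_zero, Lp.coeFn_zero _ _ _, (Lp.coeFn_zero _ _ _).trans ?_⟩
    refine Eventually.of_forall fun x => ?_
    have h : VField.grad (N := N) (0 : M → ℝ) x = 0 := VField.grad_eq_zero (by simp)
    simp [h]
  add_mem' := by
    rintro z w ⟨φ, hφ, h1, h2⟩ ⟨ψ, hψ, h3, h4⟩
    refine ⟨φ + ψ, hφ.add hψ, (Lp.coeFn_add _ _).trans (h1.add h3), (Lp.coeFn_add _ _).trans ?_⟩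
    filter_upwards [h2, h4] with x h2 h4
    simp [h2, h4, VField.grad_add hφ hψ]
  smul_mem' := by
    rintro c z ⟨φ, hφ, h1, h2⟩
    refine ⟨c • φ, hφ.smul c, (Lp.coeFn_smul _ _).trans (h1.const_smul c),
      (Lp.coeFn_smul _ _).trans ?_⟩
    filter_upwards [h2] with x h2
    simp [h2, VField.grad_smul c hφ, smul_comm c s]

variable [IsFiniteMeasureOnCompacts μ]

theorem IsMeasurableFrame.exists_mem_gradGraph (hO : IsMeasurableFrame μ O) (s : ℝ) {φ : M → ℝ}
    (hφ : IsTestFun N φ) : ∃ z ∈ gradGraph μ O s, z.fst =ᵐ[μ] φ ∧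
      z.snd =ᵐ[μ] fun x => s • O x (VField.grad φ x) := by
  have h1 : MemLp φ 2 μ := hφ.1.continuous.memLp_of_hasCompactSupport hφ.2
  have h2 : MemLp (fun x => s • O x (VField.grad φ x)) 2 μ :=
    (hO.memLp_comp (hφ.grad_memLp 2)).const_smul s
  exact ⟨WithLp.toLp 2 (h1.toLp, h2.toLp), ⟨φ, hφ, h1.coeFn_toLp, h2.coeFn_toLp⟩,
    h1.coeFn_toLp, h2.coeFn_toLp⟩

/-- The orthogonal projection of `(f, 0)` to the closure of the pairs `(φ, √t ∇φ)` is
`(u, √t ∇u)` with `u = (1 + tΔ)⁻¹ f`. -/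
theorem IsMeasurableFrame.isResolvent_of_orthogonal (hO : IsMeasurableFrame μ O) {t : ℝ}
    (ht : 0 < t) {f : Lp ℝ 2 μ} {f' : M → ℝ} (hf : f =ᵐ[μ] f') {z : PairSpace N μ}
    (hz : z ∈ (gradGraph μ O √t).topologicalClosure)
    (horth : ∀ w ∈ (gradGraph μ O √t).topologicalClosure,
      inner ℝ (WithLp.toLp 2 (f, 0) - z) w = 0) :
    IsResolvent (N := N) μ t f' z.fst (fun x => (O x).symm ((√t)⁻¹ • z.snd x)) := by
  have hst : 0 < √t := Real.sqrt_pos.2 ht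
  have hu : MemLp z.fst 2 μ := Lp.memLp _
  have hX : VField.MemLp (N := N) (fun x => (O x).symm ((√t)⁻¹ • z.snd x)) 2 μ :=
    hO.memLp_symm ((Lp.memLp z.snd).const_smul (√t)⁻¹)
  have hf' : MemLp f' 2 μ := (memLp_congr_ae hf).1 (Lp.memLp f)
  -- The equation $u+t\,\Delta u=f$ forces this choice of $\Delta u$.
  refine ⟨fun x => t⁻¹ * (f' x - z.fst x), ⟨⟨hu, hX, ?_⟩, (hf'.sub hu).const_mul t⁻¹, ?_⟩, ?_⟩
  · obtain ⟨w, hw, hlim⟩ := mem_closure_iff_seq_limit.1 hz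
    choose φ hφ h1 h2 using hw
    refine ⟨φ, hφ, ?_, ?_⟩
    · have hfst : Tendsto (fun k => (w k).fst) atTop (𝓝 z.fst) :=
        ((WithLp.continuous_fst 2 _ _).tendsto z).comp hlim
      have := (Lp.tendsto_Lp_iff_tendsto_eLpNorm' _ _).1 hfst
      refine this.congr fun k => eLpNorm_congr_ae ?_
      filter_upwards [h1 k] with x hx
      simp [hx]
    · have hsnd : Tendsto (fun k => (w k).snd) atTop (𝓝 z.snd) :=
        ((WithLp.continuous_snd 2 _ _).tendsto z).comp hlim
      have h3 := (Lp.tendsto_Lp_iff_tendsto_eLpNorm' _ _).1 (hsnd.const_smul (√t)⁻¹)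
      refine h3.congr fun k => ?_
      rw [← eLpNorm_norm]
      refine eLpNorm_congr_ae ?_
      filter_upwards [h2 k, Lp.coeFn_smul (√t)⁻¹ (w k).snd, Lp.coeFn_smul (√t)⁻¹ z.snd]
        with x hx hx1 hx2
      simp only [Pi.sub_apply, hx1, hx2, Pi.smul_apply, hx]
      rw [smul_smul, inv_mul_cancel₀ hst.ne', one_smul, ← (O x).symm.norm_map, map_sub,
        LinearIsometryEquiv.symm_apply_apply]
  -- Orthogonality to $(\varphi,\sqrt t\,\nabla\varphi)$ says $\langle
  -- f-u,\varphi\rangle=t\langle\nabla u,\nabla\varphi\rangle$, the weak form of $t\,\Delta u=f-u$.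
  · intro φ hφ
    obtain ⟨w, hw, h1, h2⟩ := hO.exists_mem_gradGraph √t hφ
    have h := horth w (Submodule.le_topologicalClosure _ hw)
    rw [WithLp.prod_inner_apply] at h
    have e1 : ∫ x, t⁻¹ * (f' x - z.fst x) * φ x ∂μ = t⁻¹ * inner ℝ (f - z.fst) w.fst := by
      rw [L2.inner_def, ← integral_const_mul]
      refine integral_congr_ae ?_
      filter_upwards [hf, h1, Lp.coeFn_sub f z.fst] with x hx hx1 hx2
      rw [hx1, hx2]
      simp [hx]
      ring
    have e2 : ∫ x, inner ℝ ((O x).symm ((√t)⁻¹ • z.snd x)) (VField.grad (N := N) φ x) ∂μ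
        = t⁻¹ * inner ℝ z.snd w.snd := by
      rw [L2.inner_def, ← integral_const_mul]
      refine integral_congr_ae ?_
      filter_upwards [h2] with x hx
      rw [hx, ← (O x).inner_map_map, LinearIsometryEquiv.apply_symm_apply, real_inner_smul_left,
        real_inner_smul_right, ← mul_assoc]
      congr 1
      rw [inv_mul_eq_div, Real.sqrt_div_self']
      exact (one_div _).symm
    rw [e1, e2]
    congr 1
    have h' : inner ℝ (f - z.fst) w.fst + inner ℝ (0 - z.snd) w.snd = 0 := h
    rw [zero_sub, inner_neg_left] at h'
    linarith
  · refine Eventually.of_forall fun x => ?_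
    field_simp
    ring

/-- The bounded operators `(1 + tΔ)⁻¹` and, in an orthonormal frame, `√t ∇ (1 + tΔ)⁻¹`. -/
theorem IsMeasurableFrame.exists_resolvent (hO : IsMeasurableFrame μ O) {t : ℝ} (ht : 0 < t) :
    ∃ (R : Lp ℝ 2 μ →L[ℝ] Lp ℝ 2 μ) (G : Lp ℝ 2 μ →L[ℝ] Lp (EuclideanSpace ℝ (Fin N)) 2 μ),
      ∀ (f : Lp ℝ 2 μ) (f' : M → ℝ), f =ᵐ[μ] f' →
        IsResolvent (N := N) μ t f' (R f) (fun x => (O x).symm ((√t)⁻¹ • G f x)) := by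
  let W := (gradGraph μ O √t).topologicalClosure
  have : CompleteSpace W := (Submodule.isClosed_topologicalClosure _).completeSpace_coe
  let eqv := WithLp.prodContinuousLinearEquiv 2 ℝ (Lp ℝ 2 μ)
    (Lp (EuclideanSpace ℝ (Fin N)) 2 μ)
  let Q : Lp ℝ 2 μ →L[ℝ] (Lp ℝ 2 μ × Lp (EuclideanSpace ℝ (Fin N)) 2 μ) :=
    eqv.toContinuousLinearMap ∘L W.starProjection ∘L eqv.symm.toContinuousLinearMap ∘L
      ContinuousLinearMap.inl ℝ _ _
  refine ⟨ContinuousLinearMap.fst ℝ _ _ ∘L Q, ContinuousLinearMap.snd ℝ _ _ ∘L Q,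
    fun f f' hf => ?_⟩
  exact hO.isResolvent_of_orthogonal ht hf
    (z := W.starProjection (WithLp.toLp 2 (f, 0))) (Submodule.starProjection_apply_mem W _)
    fun w hw => Submodule.starProjection_inner_eq_zero _ w hw

/-- The bounded operator that is, in an orthonormal frame, `√t ∇ (1 + tΔ)^{-m}`. -/
theorem IsMeasurableFrame.exists_gradResolventPow (hO : IsMeasurableFrame μ O) {t : ℝ}
    (ht : 0 < t) {m : ℕ} (hm : 1 ≤ m) :
    ∃ G : Lp ℝ 2 μ →L[ℝ] Lp (EuclideanSpace ℝ (Fin N)) 2 μ,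
      ∀ (f : Lp ℝ 2 μ) (f' : M → ℝ), f =ᵐ[μ] f' →
        IsGradResolventPow (N := N) μ t m f' (fun x => (O x).symm ((√t)⁻¹ • G f x)) := by
  obtain ⟨R, G, hRG⟩ := hO.exists_resolvent ht
  induction m, hm using Nat.le_induction with
  | base => exact ⟨G, fun f f' hf => ⟨R f, hRG f f' hf⟩⟩
  | succ m hm ih =>
    obtain ⟨D, hD⟩ := ih
    obtain ⟨k, rfl⟩ := Nat.exists_eq_add_of_le' hm
    exact ⟨D ∘L R, fun f f' hf => ⟨R f, _, hRG f f' hf, hD (R f) (R f) EventuallyEq.rfl⟩⟩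

end Resolvent

/-! ### Suprema in the lattice of measurable functions -/

/-- The map $x\mapsto x/(1+x)$ compresses $[0,\infty]$ into $[0,1]$ and keeps strict order, so
arbitrary functions can be compared through finite integrals. -/
theorem strictMono_inv_inv_add_one : StrictMono fun x : ℝ≥0∞ => (x⁻¹ + 1)⁻¹ := by
  intro x y hxy
  exact ENNReal.inv_lt_inv.2
    (ENNReal.add_lt_add_right ENNReal.one_ne_top (ENNReal.inv_lt_inv.2 hxy))

/-- A family of measurable functions has a least measurable function that dominates each of its
members almost everywhere. -/
theorem exists_ae_isLUB {α ι : Type*} [MeasurableSpace α] {μ : Measure α} [SigmaFinite μ]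
    {h : ι → α → ℝ≥0∞} (hm : ∀ i, AEMeasurable (h i) μ) :
    ∃ g : α → ℝ≥0∞, AEMeasurable g μ ∧ (∀ i, ∀ᵐ x ∂μ, h i x ≤ g x) ∧
      ∀ g' : α → ℝ≥0∞, (∀ i, ∀ᵐ x ∂μ, h i x ≤ g' x) → ∀ᵐ x ∂μ, g x ≤ g' x := by
  let G : Set ι → α → ℝ≥0∞ := fun S x => ⨆ i ∈ S, h i x
  let b : ℝ≥0∞ → ℝ≥0∞ := fun x => (x⁻¹ + 1)⁻¹
  have hb1 : ∀ x, b x ≤ 1 := fun x => ENNReal.inv_le_one.2 le_add_self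
  have hbm : Measurable b := by fun_prop
  have hae : ae μ.toFinite = ae μ := ae_toFinite
  have hbG : ∀ S : Set ι, S.Countable → AEMeasurable (fun x => b (G S x)) μ.toFinite := fun S hS =>
    hbm.comp_aemeasurable
      (AEMeasurable.biSup S hS fun i _ => (hm i).mono_ac (toFinite_absolutelyContinuous μ))
  let I : Set ι → ℝ≥0∞ := fun S => ∫⁻ x, b (G S x) ∂μ.toFinite
  have hI : ∀ S T, S ⊆ T → I S ≤ I T := fun S T hST => lintegral_mono fun x =>
    strictMono_inv_inv_add_one.monotone (biSup_mono fun i hi => hST hi)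
  -- The compressed integral of the supremum over a countable index set is maximized, for a finite
  -- measure with the same null sets as `μ`. The union `T` of a maximizing sequence attains the
  -- maximum. Adding one index to `T` cannot raise the integral, so it changes the supremum only on
  -- a null set.
  obtain ⟨c, -, hc, hcmem⟩ := exists_seq_tendsto_sSup (S := I '' {S | S.Countable})
    ⟨_, ∅, countable_empty, rfl⟩ (OrderTop.bddAbove _)
  choose S hS hSc using hcmem
  let T : Set ι := ⋃ k, S k
  have hT : T.Countable := countable_iUnion hS
  have hTmax : ∀ U : Set ι, U.Countable → I U ≤ I T := fun U hU =>
    (le_sSup (mem_image_of_mem I hU)).trans (le_of_tendsto' hc fun k =>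
      (hSc k).symm.trans_le (hI _ _ (subset_iUnion S k)))
  refine ⟨G T, AEMeasurable.biSup T hT fun i _ => hm i, fun i => ?_, fun g' hg' => ?_⟩
  · have hle : ∀ x, b (G T x) ≤ b (G (insert i T) x) := fun x =>
      strictMono_inv_inv_add_one.monotone (biSup_mono fun j hj => mem_insert_of_mem i hj)
    have hfin : I T ≠ ⊤ := by
      refine ((lintegral_mono fun x => hb1 (G T x)).trans_lt ?_).ne
      simp
    have heq := ae_eq_of_ae_le_of_lintegral_le (Eventually.of_forall hle) hfin
      (hbG _ (hT.insert i)) (hTmax _ (hT.insert i))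
    rw [Filter.EventuallyEq, hae] at heq
    filter_upwards [heq] with x hx
    have hx' : G T x = G (insert i T) x := strictMono_inv_inv_add_one.injective hx
    rw [hx']
    exact le_iSup₂ (f := fun j (_ : j ∈ insert i T) => h j x) i (mem_insert i T)
  · have : ∀ᵐ x ∂μ, ∀ i ∈ T, h i x ≤ g' x := (ae_ball_iff hT).2 fun i _ => hg' i
    filter_upwards [this] with x hx
    exact iSup₂_le hx

/-! ### Vector fields in an orthonormal frame -/

section FrameIsometry

variable {N : ℕ} {M : Type*} [TopologicalSpace M] [SecondCountableTopology M]
  [ChartedSpace (EuclideanSpace ℝ (Fin N)) M] [IsManifold (𝓡 N) ∞ M]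
  [RiemannianBundle (fun x : M => TangentSpace (𝓡 N) x)]
  [IsContMDiffRiemannianBundle (𝓡 N) ∞ (EuclideanSpace ℝ (Fin N))
    (fun x : M => TangentSpace (𝓡 N) x)]
  [MeasurableSpace M] [BorelSpace M] {μ : Measure M}
  {O : ∀ x : M, TangentSpace (𝓡 N) x ≃ₗᵢ[ℝ] EuclideanSpace ℝ (Fin N)}
  {p : ℝ≥0∞} [Fact (1 ≤ p)]

theorem VField.MemLp.toLp_congr {X Y : VField N M} (hX : X.MemLp p μ) (hY : Y.MemLp p μ)
    (h : ∀ᵐ x ∂μ, X x = Y x) : hX.toLp = hY.toLp := by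
  refine SeparationQuotient.mk_eq_mk.2 (Metric.inseparable_iff.2 ?_)
  refine (dist_eq_norm (E := VField.PreLp N M p μ) _ _).trans ?_
  change (eLpNorm (fun x => ‖X x - Y x‖) p μ).toReal = 0
  have : (fun x => ‖X x - Y x‖) =ᵐ[μ] fun _ => (0 : ℝ) := by
    filter_upwards [h] with x hx
    rw [hx, sub_self, norm_zero]
  rw [eLpNorm_congr_ae this]
  simp

/-- In an orthonormal frame, functions with values in the Euclidean space become vector fields. -/
noncomputable def IsMeasurableFrame.toLpVField (hO : IsMeasurableFrame μ O) :
    Lp (EuclideanSpace ℝ (Fin N)) p μ →ₗᵢ[ℝ] LpVField N M p μ where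
  toFun F := (hO.memLp_symm (Lp.memLp F)).toLp
  map_add' F G := by
    refine (VField.MemLp.toLp_congr _ ((VField.preLpSubmodule N M p μ).add_mem
      (hO.memLp_symm (Lp.memLp F)) (hO.memLp_symm (Lp.memLp G))) ?_).trans rfl
    filter_upwards [Lp.coeFn_add F G] with x hx
    rw [hx, Pi.add_apply, map_add]
    rfl
  map_smul' c F := by
    refine (VField.MemLp.toLp_congr _ ((VField.preLpSubmodule N M p μ).smul_mem c
      (hO.memLp_symm (Lp.memLp F))) ?_).trans rfl
    filter_upwards [Lp.coeFn_smul c F] with x hx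
    rw [hx, Pi.smul_apply, map_smul]
    rfl
  norm_map' F := by
    change ‖(hO.memLp_symm (Lp.memLp F)).toLp‖ = _
    rw [VField.MemLp.norm_toLp, Lp.norm_def]
    simp only [LinearIsometryEquiv.norm_map, eLpNorm_norm]

end FrameIsometry

/-! ### Extension of operators to `L^p` -/

section Extension

variable {α : Type*} [MeasurableSpace α] {μ : Measure α} {p : ℝ≥0∞}

/-- The subspace `L² ∩ L^p` of `L^p`. -/
def l2Submodule (μ : Measure α) (p : ℝ≥0∞) : Submodule ℝ (Lp ℝ p μ) where
  carrier := {f | MemLp f 2 μ}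
  zero_mem' := (memLp_congr_ae (Lp.coeFn_zero ℝ p μ)).2 MemLp.zero
  add_mem' {f g} hf hg := (memLp_congr_ae (Lp.coeFn_add f g)).2 (MemLp.add hf hg)
  smul_mem' c f hf := (memLp_congr_ae (Lp.coeFn_smul c f)).2 (MemLp.const_smul hf c)

/-- Simple functions in $L^p$ live on sets of finite measure, hence lie in $L^2$, and they are dense
for $p<\infty$. -/
theorem dense_l2Submodule [Fact (1 ≤ p)] (hp : p ≠ ⊤) :
    Dense (l2Submodule μ p : Set (Lp ℝ p μ)) := by
  have hp0 : p ≠ 0 := (zero_lt_one.trans_le Fact.out).ne'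
  refine (Lp.simpleFunc.dense (E := ℝ) (μ := μ) hp).mono fun f hf => ?_
  let g : Lp.simpleFunc ℝ p μ := ⟨f, hf⟩
  have h1 : MemLp (Lp.simpleFunc.toSimpleFunc g) 2 μ :=
    (SimpleFunc.memLp_iff two_ne_zero ENNReal.ofNat_ne_top).2
      ((SimpleFunc.memLp_iff hp0 hp).1 (Lp.simpleFunc.memLp g))
  exact (memLp_congr_ae (Lp.simpleFunc.toSimpleFunc_eq_toFun g)).1 h1

theorem memLp_two_of_mem (f : l2Submodule μ p) : MemLp (f.1 : α → ℝ) 2 μ := f.2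

/-- The inclusion of `L² ∩ L^p` in `L²`. -/
noncomputable def l2Inclusion (μ : Measure α) (p : ℝ≥0∞) : l2Submodule μ p →ₗ[ℝ] Lp ℝ 2 μ where
  toFun f := (memLp_two_of_mem f).toLp
  map_add' f g := by
    rw [← MemLp.toLp_add]
    exact MemLp.toLp_congr _ _ (Lp.coeFn_add f.1 g.1)
  map_smul' c f := by
    rw [RingHom.id_apply, ← MemLp.toLp_const_smul]
    exact MemLp.toLp_congr _ _ (Lp.coeFn_smul c f.1)

/-- Operators on `L²` that satisfy a square function estimate in `L^p` extend to `L^p`. -/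
theorem exists_extension_of_square_function [Fact (1 ≤ p)] (hp : p ≠ ⊤) {E : Type*}
    [NormedAddCommGroup E] [NormedSpace ℝ E] [CompleteSpace E] (D : Lp ℝ 2 μ →L[ℝ] Lp E 2 μ)
    (A : ℝ≥0)
    (hA : ∀ f : α → ℝ, ∀ h2 : MemLp f 2 μ, MemLp f p μ →
      eLpNorm (D h2.toLp) p μ ≤ A * eLpNorm f p μ) :
    ∃ S : Lp ℝ p μ →L[ℝ] Lp E p μ, ∀ f : α → ℝ, ∀ (h2 : MemLp f 2 μ) (hfp : MemLp f p μ),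
      S hfp.toLp =ᵐ[μ] D h2.toLp := by
  have hbd : ∀ f, eLpNorm (D (l2Inclusion μ p f)) p μ ≤ A * eLpNorm f.1 p μ := fun f =>
    hA f.1 f.2 (Lp.memLp f.1)
  have hmem : ∀ f, MemLp (D (l2Inclusion μ p f)) p μ := fun f =>
    ⟨Lp.aestronglyMeasurable _, (hbd f).trans_lt
      (ENNReal.mul_lt_top ENNReal.coe_lt_top (Lp.memLp f.1).2)⟩
  let L : l2Submodule μ p →ₗ[ℝ] Lp E p μ :=
    { toFun := fun f => (hmem f).toLp
      map_add' := fun f g => by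
        rw [← MemLp.toLp_add]
        refine MemLp.toLp_congr _ _ ?_
        rw [map_add, map_add]
        exact Lp.coeFn_add _ _
      map_smul' := fun c f => by
        rw [RingHom.id_apply, ← MemLp.toLp_const_smul]
        refine MemLp.toLp_congr _ _ ?_
        rw [map_smul, map_smul]
        exact Lp.coeFn_smul _ _ }
  have hdense : DenseRange (l2Submodule μ p).subtype := by
    simpa [DenseRange] using dense_l2Submodule hp
  have hbound : ∀ f, ‖L f‖ ≤ A * ‖(l2Submodule μ p).subtype f‖ := fun f => by
    change ‖(hmem f).toLp‖ ≤ A * ‖f.1‖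
    rw [Lp.norm_toLp, Lp.norm_def, ← ENNReal.coe_toReal, ← ENNReal.toReal_mul]
    exact ENNReal.toReal_mono (ENNReal.mul_ne_top ENNReal.coe_ne_top (Lp.memLp f.1).2.ne)
      (hbd f)
  refine ⟨L.extendOfNorm (l2Submodule μ p).subtype, fun f h2 hfp => ?_⟩
  have hfV : hfp.toLp ∈ l2Submodule μ p := (memLp_congr_ae hfp.coeFn_toLp).2 h2
  have h := LinearMap.extendOfNorm_eq hdense ⟨A, hbound⟩ ⟨hfp.toLp, hfV⟩
  rw [Submodule.subtype_apply] at h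
  rw [h]
  refine (MemLp.coeFn_toLp (hmem _)).trans ?_
  have : l2Inclusion μ p ⟨hfp.toLp, hfV⟩ = h2.toLp :=
    MemLp.toLp_congr (memLp_two_of_mem _) h2 hfp.coeFn_toLp
  rw [this]

end Extension

/-! ### Square function estimates from the Fefferman–Stein inequality -/

theorem enorm_sqrt_sum_sq {J : ℕ} {E : Type*} [NormedAddCommGroup E] (a : Fin J → E) :
    ‖√(∑ j, ‖a j‖ ^ 2)‖ₑ = (∑ j, ‖a j‖ₑ ^ 2) ^ (1 / 2 : ℝ) := by
  rw [Real.enorm_of_nonneg (Real.sqrt_nonneg _), Real.sqrt_eq_rpow,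
    ← ENNReal.ofReal_rpow_of_nonneg (Finset.sum_nonneg fun _ _ => sq_nonneg _) (by norm_num),
    ENNReal.ofReal_sum_of_nonneg fun _ _ => sq_nonneg _]
  simp only [ENNReal.ofReal_pow (norm_nonneg _), ofReal_norm]

section SquareFunction

variable {N : ℕ} {M : Type*} [TopologicalSpace M]
  [ChartedSpace (EuclideanSpace ℝ (Fin N)) M] [IsManifold (𝓡 N) ∞ M]
  [RiemannianBundle (fun x : M => TangentSpace (𝓡 N) x)]
  [MeasurableSpace M] {μ : Measure M} [SigmaFinite μ]
  {O : ∀ x : M, TangentSpace (𝓡 N) x ≃ₗᵢ[ℝ] EuclideanSpace ℝ (Fin N)} {m : ℕ} {p : ℝ≥0∞}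

/-- The vertical maximal function of a square integrable function exists. -/
theorem exists_isVerticalMaximal
    {D : Ioi (0 : ℝ) → Lp ℝ 2 μ →L[ℝ] Lp (EuclideanSpace ℝ (Fin N)) 2 μ}
    (hD : ∀ (t : Ioi (0 : ℝ)) (f : Lp ℝ 2 μ) (f' : M → ℝ), f =ᵐ[μ] f' →
      IsGradResolventPow (N := N) μ t m f' (fun x => (O x).symm ((√t)⁻¹ • D t f x)))
    {f : M → ℝ} (hf : MemLp f 2 μ) :
    ∃ g : M → ℝ≥0∞, IsVerticalMaximal N μ m f g ∧
      ∀ t : Ioi (0 : ℝ), ∀ᵐ x ∂μ, ‖D t hf.toLp x‖ₑ ≤ g x := by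
  obtain ⟨g, hgm, hg1, hg2⟩ := exists_ae_isLUB (μ := μ)
    (h := fun (t : Ioi (0 : ℝ)) x => ‖D t hf.toLp x‖ₑ)
    fun t => (Lp.aestronglyMeasurable _).enorm
  -- The fields must be given for all real $t$; the value for $t\le0$ is immaterial.
  let X : ℝ → VField N M := fun t x =>
    if ht : 0 < t then (O x).symm ((√t)⁻¹ • D ⟨t, ht⟩ hf.toLp x) else 0
  have hX : ∀ t (ht : 0 < t), X t = fun x => (O x).symm ((√t)⁻¹ • D ⟨t, ht⟩ hf.toLp x) :=
    fun t ht => by funext x; simp only [X, dif_pos ht]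
  have hnorm : ∀ t (ht : 0 < t) x,
      ENNReal.ofReal ‖√t • X t x‖ = ‖D ⟨t, ht⟩ hf.toLp x‖ₑ := fun t ht x => by
    rw [hX t ht, ← map_smul, smul_smul, mul_inv_cancel₀ (Real.sqrt_pos.2 ht).ne', one_smul,
      LinearIsometryEquiv.norm_map, ofReal_norm]
  refine ⟨g, ⟨X, fun t ht => ?_, hgm, fun t ht => ?_, fun g' _ hg' => hg2 g' fun t => ?_⟩, hg1⟩
  · rw [hX t ht]
    exact hD ⟨t, ht⟩ hf.toLp f hf.coeFn_toLp
  · filter_upwards [hg1 ⟨t, ht⟩] with x hx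
    rwa [hnorm t ht]
  · filter_upwards [hg' t t.2] with x hx
    rwa [hnorm t t.2] at hx

/-- The Fefferman–Stein inequality for the vertical maximal function yields a square function
estimate for the operators `√t ∇ (1 + tΔ)^{-m}`. -/
theorem FeffermanStein.exists_square_function (hFS : FeffermanStein N μ m p)
    {D : Ioi (0 : ℝ) → Lp ℝ 2 μ →L[ℝ] Lp (EuclideanSpace ℝ (Fin N)) 2 μ}
    (hD : ∀ (t : Ioi (0 : ℝ)) (f : Lp ℝ 2 μ) (f' : M → ℝ), f =ᵐ[μ] f' →
      IsGradResolventPow (N := N) μ t m f' (fun x => (O x).symm ((√t)⁻¹ • D t f x))) :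
    ∃ A : ℝ≥0, ∀ (J : ℕ) (t : Fin J → Ioi (0 : ℝ)) (f : Fin J → M → ℝ)
      (h2 : ∀ j, MemLp (f j) 2 μ), (∀ j, MemLp (f j) p μ) →
      eLpNorm (fun x => √(∑ j, ‖D (t j) (h2 j).toLp x‖ ^ 2)) p μ
        ≤ A * eLpNorm (fun x => √(∑ j, (f j x) ^ 2)) p μ := by
  obtain ⟨A, -, hA⟩ := hFS
  refine ⟨A, fun J t f h2 hfp => ?_⟩
  -- Padding by zeros turns the finite family into a sequence; the padding adds nothing to the
  -- right-hand side.
  let F : ℕ → M → ℝ := fun i => if h : i < J then f ⟨i, h⟩ else 0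
  have hFj : ∀ j : Fin J, F j = f j := fun j => dif_pos j.2
  have hF0 : ∀ i, ¬ i < J → F i = 0 := fun i hi => dif_neg hi
  have hF : ∀ {q : ℝ≥0∞}, (∀ j, MemLp (f j) q μ) → ∀ i, MemLp (F i) q μ := fun {q} hq i => by
    by_cases hi : i < J
    · exact hFj ⟨i, hi⟩ ▸ hq ⟨i, hi⟩
    · rw [hF0 i hi]
      exact MemLp.zero
  choose g hg hgD using fun i => exists_isVerticalMaximal hD (hF h2 i)
  have key := hA F g (hF h2) (hF hfp) hg
  have hlhs : eLpNorm (fun x => √(∑ j, ‖D (t j) (h2 j).toLp x‖ ^ 2)) p μ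
      ≤ eLpNorm (fun x => (∑' i, g i x ^ 2) ^ (1 / 2 : ℝ)) p μ := by
    refine eLpNorm_mono_enorm_ae ?_
    -- The maximal function of $f_j$ dominates all times at once, so each $j$ may have its own
    -- $t_j$. Only finitely many null sets are discarded.
    have hle : ∀ᵐ x ∂μ, ∀ j : Fin J, ‖D (t j) (h2 j).toLp x‖ₑ ≤ g j x := by
      refine ae_all_iff.2 fun j => ?_
      have hj : (h2 j).toLp = (hF h2 j).toLp :=
        MemLp.toLp_congr _ _ (Eventually.of_forall fun x => by rw [hFj])
      rw [hj]
      exact hgD j (t j)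
    filter_upwards [hle] with x hx
    rw [enorm_sqrt_sum_sq, enorm_eq_self]
    gcongr
    calc ∑ j, ‖D (t j) (h2 j).toLp x‖ₑ ^ 2 ≤ ∑ j : Fin J, g j x ^ 2 := by
          gcongr with j; exact hx j
      _ = ∑ i ∈ Finset.range J, g i x ^ 2 := (Finset.sum_range fun i => g i x ^ 2).symm
      _ ≤ _ := ENNReal.sum_le_tsum _
  have hrhs : eLpNorm (fun x => (∑' i, ENNReal.ofReal |F i x| ^ 2) ^ (1 / 2 : ℝ)) p μ
      = eLpNorm (fun x => √(∑ j, (f j x) ^ 2)) p μ := by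
    refine eLpNorm_congr_enorm_ae (Eventually.of_forall fun x => ?_)
    have h := enorm_sqrt_sum_sq fun j => f j x
    simp only [Real.norm_eq_abs, sq_abs] at h
    simp only [enorm_eq_self]
    rw [h, tsum_eq_sum (s := Finset.range J) fun i hi => by
      rw [hF0 i (by simpa using hi)]; simp, Finset.sum_range]
    simp only [hFj, ← Real.enorm_eq_ofReal_abs]
  exact hlhs.trans (key.trans_eq (by rw [hrhs]))

end SquareFunction

/-! ### R-boundedness of the vertical resolvents -/

theorem exists_isVerticalResolvent_rBounded {N : ℕ} {M : Type*} [TopologicalSpace M] [T2Space M]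
    [SecondCountableTopology M] [ChartedSpace (EuclideanSpace ℝ (Fin N)) M]
    [IsManifold (𝓡 N) ∞ M] [RiemannianBundle (fun x : M => TangentSpace (𝓡 N) x)]
    [IsContMDiffRiemannianBundle (𝓡 N) ∞ (EuclideanSpace ℝ (Fin N))
      (fun x : M => TangentSpace (𝓡 N) x)]
    [MeasurableSpace M] [BorelSpace M] {μ : Measure M} [IsLocallyFiniteMeasure μ] {m : ℕ}
    (hm : 1 ≤ m) {p : ℝ≥0∞} [Fact (1 ≤ p)] (hp : p ≠ ⊤) (hFS : FeffermanStein N μ m p) :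
    ∃ T : Ioi (0 : ℝ) → (Lp ℝ p μ →L[ℝ] LpVField N M p μ),
      (∀ t : Ioi (0 : ℝ), IsVerticalResolvent μ m t (T t)) ∧ RBounded (range T) := by
  obtain ⟨O, hO⟩ := exists_isMeasurableFrame N M μ
  choose D hD using fun t : Ioi (0 : ℝ) => hO.exists_gradResolventPow (mem_Ioi.1 t.2) hm
  obtain ⟨A, hA⟩ := hFS.exists_square_function hD
  -- A single function, $J=1$, gives the $L^p$ bound needed for the extension.
  have hA1 : ∀ (t : Ioi (0 : ℝ)) (f : M → ℝ) (h2 : MemLp f 2 μ), MemLp f p μ →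
      eLpNorm (D t h2.toLp) p μ ≤ A * eLpNorm f p μ := fun t f h2 hfp => by
    have h := hA 1 (fun _ => t) (fun _ => f) (fun _ => h2) fun _ => hfp
    simpa [Real.sqrt_sq_eq_abs, ← Real.norm_eq_abs, eLpNorm_norm] using h
  choose S hS using fun t => exists_extension_of_square_function hp (D t) A (hA1 t)
  refine ⟨fun t => hO.toLpVField.toContinuousLinearMap.comp (S t), fun t f hfp h2 => ?_, ?_⟩
  · have ht : 0 < √(t : ℝ) := Real.sqrt_pos.2 t.2
    refine ⟨_, hD t h2.toLp f h2.coeFn_toLp, ?_⟩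
    -- `D t` already contains the factor $\sqrt t$, so the gradient carries $(\sqrt t)^{-1}$, which
    -- cancels here.
    have hX : √(t : ℝ) • (fun x => (O x).symm ((√(t : ℝ))⁻¹ • D t h2.toLp x) : VField N M)
        = fun x => (O x).symm (D t h2.toLp x) := by
      funext x
      rw [Pi.smul_apply, ← map_smul, smul_smul, mul_inv_cancel₀ ht.ne', one_smul]
    have hmem : MemLp (D t h2.toLp) p μ := (memLp_congr_ae (hS t f h2 hfp)).1 (Lp.memLp _)
    rw [hX]
    refine ⟨hO.memLp_symm hmem, VField.MemLp.toLp_congr _ _ ?_⟩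
    filter_upwards [hS t f h2 hfp] with x hx
    exact congrArg (O x).symm hx
  · refine RBounded.of_square_function hp hO.toLpVField S (dense_l2Submodule hp) A
      fun J t f hf => ?_
    have h := hA J t (fun j => f j) hf fun j => Lp.memLp (f j)
    refine (eLpNorm_congr_ae ?_).trans_le h
    have hS' : ∀ᵐ x ∂μ, ∀ j, S (t j) (f j) x = D (t j) (MemLp.toLp (f j) (hf j)) x := by
      refine ae_all_iff.2 fun j => ?_
      have := hS (t j) (f j) (hf j) (Lp.memLp (f j))
      rwa [Lp.toLp_coeFn] at this
    filter_upwards [hS'] with x hx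
    simp only [hx]

theorem theorem4p1
    -- the complete Riemannian manifold `M` of dimension `N`
    (N : ℕ) (M : Type*) [EMetricSpace M] [SecondCountableTopology M] [CompleteSpace M]
    [MeasurableSpace M] [BorelSpace M] [ChartedSpace (EuclideanSpace ℝ (Fin N)) M]
    [IsManifold (𝓡 N) ∞ M] [RiemannianBundle (fun x : M => TangentSpace (𝓡 N) x)]
    [IsContMDiffRiemannianBundle (𝓡 N) ∞ (EuclideanSpace ℝ (Fin N))
      (fun x : M => TangentSpace (𝓡 N) x)]
    [IsRiemannianManifold (𝓡 N) M]
    -- the compact connected Riemannian manifolds `F i` of dimension `k i`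
    (l : ℕ) (hl : 2 ≤ l) (n k : Fin l → ℕ) (hn : ∀ i, 3 ≤ n i) (hN : ∀ i, n i + k i = N)
    (F : Fin l → Type*) [∀ i, TopologicalSpace (F i)] [∀ i, T2Space (F i)]
    [∀ i, CompactSpace (F i)] [∀ i, ConnectedSpace (F i)]
    [∀ i, ChartedSpace (EuclideanSpace ℝ (Fin (k i))) (F i)]
    [∀ i, IsManifold (𝓡 (k i)) ∞ (F i)]
    [∀ i, RiemannianBundle (fun y : F i => TangentSpace (𝓡 (k i)) y)]
    [∀ i, IsContMDiffRiemannianBundle (𝓡 (k i)) ∞ (EuclideanSpace ℝ (Fin (k i)))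
      (fun y : F i => TangentSpace (𝓡 (k i)) y)]
    -- `M` is the connected sum of the products `ℝ^{n i} × F i`
    (hM : IsConnectedSum N M n k F)
    (m : ℕ) (hm : 1 ≤ m)
    (p : ℝ≥0∞) [Fact (1 ≤ p)] (hp : 1 < p) (hpn : p < ((⨅ i, n i : ℕ) : ℝ≥0∞))
    (hFS : FeffermanStein N (M := M) μHE[N] m p) :
    ∃ T : Ioi (0 : ℝ) → (Lp ℝ p (μHE[N] : Measure M) →L[ℝ] LpVField N M p μHE[N]),
      (∀ t : Ioi (0 : ℝ), IsVerticalResolvent μHE[N] m t (T t)) ∧ RBounded (range T) := by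
  have := isLocallyFiniteMeasure_euclideanHausdorffMeasure (N := N) (M := M)
  -- Lying below a natural number, $p$ is finite, as the density of $L^2\cap L^p$ and the upper
  -- Khintchine bound require.
  exact exists_isVerticalResolvent_rBounded hm hpn.ne_top hFS
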